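/- Let $c>0$, $c\neq 1$. For $(a,v)$ in $\mathcal D_c=\{0<a\le c,\ a+v>c-1\}$ put $F_{a,v,c}(z)=\frac{a+cz}{1-vz}$, $G_{a,v,c}(z)=\frac{a(z-c)}{ac+z(1+v-c)}$ and let $\zeta_{a,v,c}=(F_{a,v,c}|_{[-1,0]},G_{a,v,c}|_{[0,a]})$. The height of $\zeta_{a,v,c}$ is the smallest $r\in\mathbb N=\{1,2,\dots\}$, if it exists, with $0\in[F^r(-1),F^{r+1}(-1))$, where $F=F_{a,v,c}$. The renormalization of a pair $\zeta_{a,v,c}$ of height $r$ is $(\alpha\circ F^{r}\circ G\circ\alpha^{-1},\ \alpha\circ F\circ\alpha^{-1})$ with $G=G_{a,v,c}$, $\alpha(x)=-x/a$; the partially defined operator $\mathcal R_c:\mathcal D_c\to\mathcal D_{1/c}$ sends $(a,v)$ to $(a',v')$ if this renormalization is $\zeta_{a',v',1/c}$, and $\mathcal T_c=\mathcal R_{1/c}\circ\mathcal R_c$. We write $\rho(\zeta_{a,v,c})=[r_0,r_1,\dots]$ when the successive renormalizations of $\zeta_{a,v,c}$ have heights $r_0,r_1,\dots$. Let $\Delta_c$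 be the set of $(a,v)\in\mathcal D_c$ with $v$ between $0$ and $c-1$ (inclusive). For positive integers $r_0,r_1,\dots$ let $L_{c,(r_0,r_1,\dots)}$ be the set of $(a,v)\in\Delta_c$ with $\rho(\zeta_{a,v,c})=[r_0,r_1,\dots]$. For positive integers $\dots,r_{-2},r_{-1}$ let $L_{c,(\dots,r_{-2},r_{-1})}$ be the set of $(a,v)\in\Delta_c$ such that for every $k\ge 0$ there is $(a_{-2k},v_{-2k})\in\Delta_c$ with $\mathcal T_c^k(a_{-2k},v_{-2k})=(a,v)$ and $\rho(\zeta_{a_{-2k},v_{-2k},c})=[r_{-2k},\dots,r_{-1},\dots]$ (the first $2k$ heights are prescribed). Let $$\mathcal I_c(a,v)=\Bigl(\frac{c-1-v}{av},\,-\frac vc\Bigr),$$ regarded as a map from a part of $\mathcal D_c$ to $\mathcal D_{1/c}$, with domain the set $E_c$ of those $(a,v)\in\mathcal D_c$ with $v\ne 0$ for which $(a',v')=\mathcal I_c(a,v)$ lies in $\mathcal D_{1/c}$ and $a'\neq 1/c$. Proposition. For every sequence $\dots,r_{-2},r_{-1}$ of positive integers, $$L_{1/c,(\dots,r_{-2},r_{-1})}=\mathcal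 I_c\bigl(L_{c,(r_{-1},r_{-2},\dots)}\cap E_c\bigr).$$ Moreover, every $L_{1/c,(\dots,r_{-2},r_{-1})}$ is a continuous curve, i.e. it is homeomorphic to a nondegenerate interval of $\mathbb R$. -/

import Mathlib

open Set

noncomputable section

namespace BreakRenorm

/-- The Möbius map `F_{a,v,c}(z) = (a + c z) / (1 - v z)`, with `p = (a, v)`. -/
def mobF (c : ℝ) (p : ℝ × ℝ) (z : ℝ) : ℝ :=
  (p.1 + c * z) / (1 - p.2 * z)

/-- The Möbius map `G_{a,v,c}(z) = a (z - c) / (a c + z (1 + v - c))`, with `p = (a, v)`. -/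
def mobG (c : ℝ) (p : ℝ × ℝ) (z : ℝ) : ℝ :=
  p.1 * (z - c) / (p.1 * c + z * (1 + p.2 - c))

/-- The parameter domain `D_c = {(a, v) : 0 < a ≤ c, a + v > c - 1}`. -/
def paramDomain (c : ℝ) : Set (ℝ × ℝ) :=
  {p | 0 < p.1 ∧ p.1 ≤ c ∧ c - 1 < p.1 + p.2}

/-- The invariant domain `Δ_c`: the part of `D_c` with `0 ≤ v ≤ c - 1` if `c > 1`, and with
`c - 1 ≤ v ≤ 0` if `c < 1`. -/
def invDomain (c : ℝ) : Set (ℝ × ℝ) :=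
  {p | p ∈ paramDomain c ∧ (1 < c → 0 ≤ p.2 ∧ p.2 ≤ c - 1) ∧ (c < 1 → c - 1 ≤ p.2 ∧ p.2 ≤ 0)}

/-- `r` is the height of the pair `(η, ξ)`: the smallest `r` for which
`0 ∈ [η^r(ξ(0)), η^{r+1}(ξ(0)))`. -/
def HasHeight (η ξ : ℝ → ℝ) (r : ℕ) : Prop :=
  IsLeast {k : ℕ | (0 : ℝ) ∈ Ico (η^[k] (ξ 0)) (η^[k + 1] (ξ 0))} r

/-- First map `α ∘ η^r ∘ ξ ∘ α⁻¹` of the renormalization of a pair `(η, ξ)` of height `r`, where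
`α(x) = -x / η(0)`. -/
def renormEta (η ξ : ℝ → ℝ) (r : ℕ) (z : ℝ) : ℝ :=
  -(η^[r] (ξ (-(η 0 * z)))) / η 0

/-- Second map `α ∘ η ∘ α⁻¹` of the renormalization of a pair `(η, ξ)`, where
`α(x) = -x / η(0)`. -/
def renormXi (η : ℝ → ℝ) (z : ℝ) : ℝ :=
  -(η (-(η 0 * z))) / η 0

/-- The graph of the (partially defined) renormalization operator `R_c : D_c → D_{1/c}`: the pair
`ζ_{p,c}` has a height and its renormalization is the pair `ζ_{q,1/c}` as a pair of maps of the
intervals `[-1, 0]` and `[0, a']`, where `q = (a', v')`. -/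
def Renorm (c : ℝ) (p q : ℝ × ℝ) : Prop :=
  p ∈ paramDomain c ∧ q ∈ paramDomain c⁻¹ ∧
    ∃ r : ℕ, HasHeight (mobF c p) (mobG c p) r ∧
      EqOn (mobF c⁻¹ q) (renormEta (mobF c p) (mobG c p) r) (Icc (-1) 0) ∧
      EqOn (mobG c⁻¹ q) (renormXi (mobF c p)) (Icc 0 q.1)

/-- The graph of `T_c = R_{1/c} ∘ R_c`. -/
def Renorm₂ (c : ℝ) (p q : ℝ × ℝ) : Prop :=
  ∃ s, Renorm c p s ∧ Renorm c⁻¹ s q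

/-- The graph of the `k`-th iterate of `T_c`. -/
def Renorm₂Iter (c : ℝ) : ℕ → ℝ × ℝ → ℝ × ℝ → Prop
  | 0, p, q => p = q
  | k + 1, p, q => ∃ s, Renorm₂ c p s ∧ Renorm₂Iter c k s q

/-- `r` is the `n`-th digit `r_n` of `ρ(ζ_{p,c}) = [r_0, r_1, …]`, that is, the height of the
`n`-th renormalization of `ζ_{p,c}` (the break parameter alternates between `c` and `1/c`). -/
def HasDigit : ℕ → ℝ → ℝ × ℝ → ℕ → Prop
  | 0, c, p, r => p ∈ paramDomain c ∧ HasHeight (mobF c p) (mobG c p) r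
  | n + 1, c, p, r => ∃ q, Renorm c p q ∧ HasDigit n c⁻¹ q r

/-- The set `S_{c,(r_{-2k}, …, r_{-2k+n-1})}`: the points `p = T_c^k(p₀)` of `Δ_c`, with `p₀` in
`Δ_c`, such that `ρ(ζ_{p₀,c}) = [r_{-2k}, …, r_{-2k+n-1}, …]`. -/
def cylinder (c : ℝ) (r : ℤ → ℕ) (k n : ℕ) : Set (ℝ × ℝ) :=
  {p | p ∈ invDomain c ∧ ∃ p₀ ∈ invDomain c, Renorm₂Iter c k p₀ p ∧
    ∀ i < n, HasDigit i c p₀ (r (-(2 * (k : ℤ)) + i))}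

/-- `L_{c,(r_0, r_1, …)} = ⋂_m S_{c,(r_0, …, r_{2m})}`. Only the digits `r i`, `i ≥ 0`, matter. -/
def forwardCurve (c : ℝ) (r : ℤ → ℕ) : Set (ℝ × ℝ) :=
  ⋂ m : ℕ, cylinder c r 0 (2 * m + 1)

/-- `L_{c,(…, r_{-2}, r_{-1})} = ⋂_k S_{c,(r_{-2k}, …, r_{-1})}`. Only the digits `r i`, `i < 0`,
matter. -/
def backwardCurve (c : ℝ) (r : ℤ → ℕ) : Set (ℝ × ℝ) :=
  ⋂ k : ℕ, cylinder c r k (2 * k)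

/-- The formula `I_c(a, v) = ((c - 1 - v) / (a v), -v / c)` of the duality involution. -/
def dualityMap (c : ℝ) (p : ℝ × ℝ) : ℝ × ℝ :=
  ((c - 1 - p.2) / (p.1 * p.2), -p.2 / c)

/-- The domain of the duality involution as a map from `D_c` to `D_{1/c}`: the points `(a, v)` of
`D_c` where the formula makes sense and gives a point `(a', v')` of `D_{1/c}` with `a' ≠ 1/c`
(for `a' = 1/c` the first map of the pair sends `-1` to `0`). -/
def dualityDomain (c : ℝ) : Set (ℝ × ℝ) :=
  {p | p ∈ paramDomain c ∧ p.2 ≠ 0 ∧ dualityMap c p ∈ paramDomain c⁻¹ ∧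
    (dualityMap c p).1 ≠ c⁻¹}

/-- A subset of the plane is a continuous curve (a simple arc, possibly without its endpoints) if it
is homeomorphic to a nondegenerate interval of the real line. -/
def IsContinuousCurve (S : Set (ℝ × ℝ)) : Prop :=
  ∃ J : Set ℝ, J.OrdConnected ∧ J.Nontrivial ∧ Nonempty (J ≃ₜ S)

end BreakRenorm

end

/-! Write v = τ(c - 1). For a pair of height r put x = F^r(-1). Each F^j ∘ G is a Möbius map whose
coefficients are read off from F^j(-1) (`iterate_mobG`), so the renormalization is explicit: a' =
-x/a and τ' = 1 + xτ (`renorm_iff`, `tau_rmap`). The map I fixes τ, sends a to (1 - τ)/(aτ), and is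
an involution.

Duality is the relation R ∘ I ∘ R = I, with the same height in both renormalizations (`Ren.dual`).
Indeed q = I(R(p)) has the same product aτ as p, so the matrices of F for p and q have the same
trace c + 1 and the same determinant c + av. Their powers are therefore the same linear combinations
of the matrix and the identity, and the signs that decide the height of p carry over to q. Thus I
reverses chains of renormalizations (`dig_reverse`) and exchanges prescribed pasts with prescribed
futures. Four renormalizations bring any point of Δ into the region where I acts.

For the curve, I pulls the vertical line a' = κ back to `dualLine c κ`, and for every κ in (0, 1/c)
exactly one point there has the prescribed heights. Existence follows from the intermediate value
theorem for finitely many heights (`exists_dig`) and compactness (`exists_dualLine`). For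
uniqueness, the pair increases strictly with a in the coordinate `coord`. The resulting gap δ
survives every renormalization while the intervals shrink to 0, where both coordinates agree
(`not_dig_of_coord_lt`). Uniqueness and closedness give continuity in κ, so the backward curve is a
graph over (0, 1/c). -/

noncomputable section

namespace BreakRenorm

/-! ### The orbit of -1 and the height -/

/-- Projection of the line to `[-1, 0]`. -/
def clamp (x : ℝ) : ℝ := max (-1) (min x 0)

/-- The orbit of `-1` under `F_{p,c}`, where points outside of `[-1, 0]` are projected to that
interval before `F_{p,c}` is applied. -/
def orb (c : ℝ) (p : ℝ × ℝ) : ℕ → ℝ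
  | 0 => -1
  | j + 1 => mobF c p (clamp (orb c p j))

/-- The pair `ζ_{p,c}` is renormalizable with height `r`. -/
def Ren (c : ℝ) (r : ℕ) (p : ℝ × ℝ) : Prop :=
  p ∈ paramDomain c ∧ orb c p r < 0 ∧ 0 < orb c p (r + 1)

/-- The parameters of the renormalization of `ζ_{p,c}`, when its height is `r`. -/
def rmap (c : ℝ) (r : ℕ) (p : ℝ × ℝ) : ℝ × ℝ :=
  (-orb c p r / p.1, (1 - orb c p r * p.2) / c - 1)

lemma clamp_mem (x : ℝ) : clamp x ∈ Icc (-1 : ℝ) 0 :=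
  ⟨le_max_left _ _, max_le (by norm_num) (min_le_right _ _)⟩

lemma clamp_eq {x : ℝ} (h : x ∈ Icc (-1 : ℝ) 0) : clamp x = x := by
  rw [clamp, min_eq_left h.2, max_eq_right h.1]

lemma clamp_of_nonneg {x : ℝ} (h : 0 ≤ x) : clamp x = 0 := by
  rw [clamp, min_eq_right h, max_eq_right (by norm_num)]

lemma one_sub_mul_pos {v z : ℝ} (hv : -1 < v) (hz : z ∈ Icc (-1 : ℝ) 0) : 0 < 1 - v * z := by
  obtain ⟨h1, h2⟩ := hz
  rcases h2.eq_or_lt with rfl | h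
  · simp
  · nlinarith [mul_pos (neg_pos.2 h) (by linarith : 0 < 1 + v)]

lemma mobF_zero (c : ℝ) (p : ℝ × ℝ) : mobF c p 0 = p.1 := by simp [mobF]

lemma mobF_neg_one (c : ℝ) (p : ℝ × ℝ) : mobF c p (-1) = (p.1 - c) / (1 + p.2) := by
  simp [mobF, sub_eq_add_neg]

lemma mobG_zero {c : ℝ} {p : ℝ × ℝ} (hc : c ≠ 0) (hp : p.1 ≠ 0) : mobG c p 0 = -1 := by
  simp only [mobG]; field_simp; ring

section
variable {c : ℝ} {p : ℝ × ℝ}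

lemma neg_one_lt_snd (hp : p ∈ paramDomain c) : -1 < p.2 := by
  obtain ⟨h1, h2, h3⟩ := hp; linarith

lemma pos_of_mem (hp : p ∈ paramDomain c) : 0 < c := by
  obtain ⟨h1, h2, h3⟩ := hp; linarith

lemma det_pos (hp : p ∈ paramDomain c) : 0 < c + p.1 * p.2 := by
  obtain ⟨h1, h2, h3⟩ := id hp
  nlinarith [mul_pos h1 (by linarith [neg_one_lt_snd hp] : 0 < 1 + p.2)]

lemma mobF_strictMonoOn (hp : p ∈ paramDomain c) : StrictMonoOn (mobF c p) (Icc (-1) 0) := by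
  intro x hx y hy hxy
  have hv := neg_one_lt_snd hp
  rw [mobF, mobF, div_lt_div_iff₀ (one_sub_mul_pos hv hx) (one_sub_mul_pos hv hy)]
  nlinarith [mul_pos (det_pos hp) (sub_pos.2 hxy)]

lemma mobF_neg_one_gt (hp : p ∈ paramDomain c) : -1 < mobF c p (-1) := by
  have hv := neg_one_lt_snd hp
  rw [mobF_neg_one, lt_div_iff₀ (by linarith)]
  linarith [hp.2.2]

lemma mobF_neg_one_nonpos (hp : p ∈ paramDomain c) : mobF c p (-1) ≤ 0 := by
  have hv := neg_one_lt_snd hp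
  rw [mobF_neg_one]
  exact div_nonpos_of_nonpos_of_nonneg (by linarith [hp.2.1]) (by linarith)

lemma mobF_gt (hp : p ∈ paramDomain c) {z : ℝ} (hz : z ∈ Icc (-1 : ℝ) 0) : -1 < mobF c p z :=
  (mobF_neg_one_gt hp).trans_le
    ((mobF_strictMonoOn hp).monotoneOn (left_mem_Icc.2 (by norm_num)) hz hz.1)

lemma orb_zero : orb c p 0 = -1 := rfl

lemma orb_succ (j : ℕ) : orb c p (j + 1) = mobF c p (clamp (orb c p j)) := rfl

lemma orb_one : orb c p 1 = (p.1 - c) / (1 + p.2) := by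
  rw [orb_succ, orb_zero, clamp_eq (left_mem_Icc.2 (by norm_num)), mobF_neg_one]

lemma orb_one_nonpos (hp : p ∈ paramDomain c) : orb c p 1 ≤ 0 := by
  rw [orb_one, ← mobF_neg_one]; exact mobF_neg_one_nonpos hp

lemma orb_ge (hp : p ∈ paramDomain c) : ∀ j, -1 ≤ orb c p j
  | 0 => le_rfl
  | _ + 1 => (mobF_gt hp (clamp_mem _)).le

lemma orb_succ_of_nonpos (hp : p ∈ paramDomain c) {j : ℕ} (h : orb c p j ≤ 0) :
    orb c p (j + 1) = mobF c p (orb c p j) := by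
  rw [orb_succ, clamp_eq ⟨orb_ge hp j, h⟩]

lemma orb_neg_of_succ (hp : p ∈ paramDomain c) {j : ℕ} (h : orb c p (j + 1) ≤ 0) :
    orb c p j < 0 := by
  by_contra! h'
  rw [orb_succ, clamp_of_nonneg h', mobF_zero] at h
  linarith [hp.1]

lemma orb_neg_of_lt (hp : p ∈ paramDomain c) {i j : ℕ} (hij : i < j) (h : orb c p j ≤ 0) :
    orb c p i < 0 := by
  induction j, hij using Nat.le_induction with
  | base => exact orb_neg_of_succ hp h
  | succ j _ ih => exact ih (orb_neg_of_succ hp h).le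

lemma orb_nonpos_of_le (hp : p ∈ paramDomain c) {i j : ℕ} (hij : i ≤ j) (h : orb c p j ≤ 0) :
    orb c p i ≤ 0 := by
  rcases hij.eq_or_lt with rfl | h'
  · exact h
  · exact (orb_neg_of_lt hp h' h).le

lemma orb_lt_succ (hp : p ∈ paramDomain c) : ∀ {j : ℕ}, orb c p j ≤ 0 → orb c p j < orb c p (j + 1)
  | 0, _ => by
    rw [orb_succ]; exact mobF_gt hp (clamp_mem _)
  | j + 1, h => by
    have h0 := orb_neg_of_succ hp h
    have h1 := orb_lt_succ hp h0.le
    rw [orb_succ_of_nonpos hp h, orb_succ_of_nonpos hp h0.le]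
    rw [orb_succ_of_nonpos hp h0.le] at h h1
    exact mobF_strictMonoOn hp ⟨orb_ge hp j, h0.le⟩ ⟨(orb_ge hp j).trans h1.le, h⟩ h1

lemma orb_lt (hp : p ∈ paramDomain c) {i j : ℕ} (hij : i < j) (h : orb c p j ≤ 0) :
    orb c p i < orb c p j := by
  induction j, hij using Nat.le_induction with
  | base => exact orb_lt_succ hp (orb_neg_of_succ hp h).le
  | succ j _ ih =>
    have h0 := (orb_neg_of_succ hp h).le
    exact (ih h0).trans (orb_lt_succ hp h0)

lemma orb_le (hp : p ∈ paramDomain c) {i j : ℕ} (hij : i ≤ j) (h : orb c p j ≤ 0) :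
    orb c p i ≤ orb c p j := by
  rcases hij.eq_or_lt with rfl | h'
  · exact le_rfl
  · exact (orb_lt hp h' h).le

lemma iterate_eq_orb (hp : p ∈ paramDomain c) :
    ∀ {j : ℕ}, (∀ i < j, orb c p i ≤ 0) → (mobF c p)^[j] (-1) = orb c p j
  | 0, _ => rfl
  | j + 1, h => by
    rw [Function.iterate_succ_apply', iterate_eq_orb hp fun i hi => h i (by omega),
      orb_succ_of_nonpos hp (h j (by omega))]

/-- The orbit increases as long as it is nonpositive, so minimality of the height is automatic and
the clamped orbit agrees with the true one up to the index r + 1. -/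
lemma hasHeight_iff (hp : p ∈ paramDomain c) {r : ℕ} :
    HasHeight (mobF c p) (mobG c p) r ↔ orb c p r ≤ 0 ∧ 0 < orb c p (r + 1) := by
  have hc := pos_of_mem hp
  rw [HasHeight, mobG_zero hc.ne' hp.1.ne']
  constructor
  · rintro ⟨⟨h1, h2⟩, h3⟩
    have key : ∀ k ≤ r, ∀ i ≤ k, orb c p i ≤ 0 := by
      intro k
      induction k with
      | zero => intro _ i hi; rw [Nat.le_zero.1 hi, orb_zero]; norm_num
      | succ k ih =>
        intro hk i hi
        have ihk := ih (by omega)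
        rcases hi.eq_or_lt with rfl | hi
        · by_contra! hpos
          have : k ∈ {k : ℕ | (0 : ℝ) ∈ Ico ((mobF c p)^[k] (-1)) ((mobF c p)^[k + 1] (-1))} := by
            constructor
            · rw [iterate_eq_orb hp fun i hi => ihk i hi.le]; exact ihk k le_rfl
            · rw [iterate_eq_orb hp fun i hi => ihk i (by omega)]; exact hpos
          have := h3 this
          omega
        · exact ihk i (by omega)
    have kr := key r le_rfl
    rw [iterate_eq_orb hp fun i hi => kr i (by omega)] at h2
    exact ⟨kr r le_rfl, h2⟩
  · rintro ⟨h1, h2⟩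
    have kr : ∀ i ≤ r, orb c p i ≤ 0 := fun i hi => orb_nonpos_of_le hp hi h1
    refine ⟨⟨?_, ?_⟩, ?_⟩
    · rw [iterate_eq_orb hp fun i hi => kr i hi.le]; exact h1
    · rw [iterate_eq_orb hp fun i hi => kr i (by omega)]; exact h2
    · rintro k ⟨_, hk⟩
      by_contra! hkr
      rw [iterate_eq_orb hp fun i hi => kr i (by omega)] at hk
      exact absurd (kr (k + 1) hkr) (not_le.2 hk)

lemma hasHeight_unique {η ξ : ℝ → ℝ} {r s : ℕ} (h : HasHeight η ξ r) (h' : HasHeight η ξ s) :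
    r = s := h.unique h'

lemma Ren.hasHeight {r : ℕ} (h : Ren c r p) : HasHeight (mobF c p) (mobG c p) r :=
  (hasHeight_iff h.1).2 ⟨h.2.1.le, h.2.2⟩

lemma Ren.one_le {r : ℕ} (h : Ren c r p) : 1 ≤ r := by
  rcases Nat.eq_zero_or_pos r with rfl | h'
  · exact absurd h.2.2 (not_lt.2 (orb_one_nonpos h.1))
  · exact h'

/-! ### Explicit form of the renormalization operator -/

/-- The denominators of the maps `F^j ∘ G` do not vanish. -/
lemma denom_pos (hp : p ∈ paramDomain c) {x u : ℝ} (hx : x ∈ Icc (-1 : ℝ) 0)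
    (hu : u ∈ Icc 0 p.1) : 0 < p.1 + ((1 - x * p.2) / c - 1) * u := by
  have hc := pos_of_mem hp
  have h := one_sub_mul_pos (neg_one_lt_snd hp) hx
  have h1 : 0 < (1 - x * p.2) / c := div_pos (by linarith [mul_comm x p.2]) hc
  rcases hu.1.eq_or_lt with h0 | h0
  · rw [← h0]; linarith [hp.1]
  · nlinarith [mul_pos h1 h0, hu.2]

/-- The point F^j(-1) alone determines F^j ∘ G. This is why the renormalized pair again belongs to
the family and depends on the height only through F^r(-1). -/
lemma iterate_mobG (hp : p ∈ paramDomain c) {u : ℝ} (hu : u ∈ Icc 0 p.1) :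
    ∀ {j : ℕ}, orb c p j ≤ 0 → (mobF c p)^[j] (mobG c p u) =
      p.1 * (u / c + orb c p j) / (p.1 + ((1 - orb c p j * p.2) / c - 1) * u)
  | 0, h => by
    have hc := pos_of_mem hp
    have h1 := denom_pos hp (x := -1) (by norm_num) hu
    rw [orb_zero, Function.iterate_zero, id, mobG]
    have h2 : p.1 + ((1 - -1 * p.2) / c - 1) * u = (p.1 * c + u * (1 + p.2 - c)) / c := by
      field_simp; ring
    rw [h2] at h1 ⊢
    have h3 : p.1 * c + u * (1 + p.2 - c) ≠ 0 := by
      rintro h; simp [h] at h1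
    field_simp
    ring
  | j + 1, h => by
    have hc := pos_of_mem hp
    have h0 := orb_neg_of_succ hp h
    rw [Function.iterate_succ_apply', iterate_mobG hp hu h0.le]
    have hx : orb c p j ∈ Icc (-1 : ℝ) 0 := ⟨orb_ge hp j, h0.le⟩
    have d1 := denom_pos hp hx hu
    have d2 := denom_pos hp (x := orb c p (j + 1)) ⟨orb_ge hp _, h⟩ hu
    have d3 := one_sub_mul_pos (neg_one_lt_snd hp) hx
    rw [orb_succ_of_nonpos hp h0.le] at d2 ⊢
    generalize orb c p j = x at *
    simp only [mobF] at d2 ⊢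
    have d4 : 1 - x * p.2 ≠ 0 := by rw [mul_comm]; exact d3.ne'
    have e1 : 1 - p.2 * (p.1 * (u / c + x) / (p.1 + ((1 - x * p.2) / c - 1) * u)) =
        (1 - p.2 * x) * (p.1 + ((1 - (p.1 + c * x) / (1 - p.2 * x) * p.2) / c - 1) * u) /
          (p.1 + ((1 - x * p.2) / c - 1) * u) := by
      rw [eq_div_iff d1.ne', sub_mul, mul_assoc, div_mul_cancel₀ _ d1.ne']
      field_simp
      ring
    have e2 : p.1 + c * (p.1 * (u / c + x) / (p.1 + ((1 - x * p.2) / c - 1) * u)) =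
        (1 - p.2 * x) * (p.1 * (u / c + (p.1 + c * x) / (1 - p.2 * x))) /
          (p.1 + ((1 - x * p.2) / c - 1) * u) := by
      rw [eq_div_iff d1.ne', add_mul, mul_assoc c, div_mul_cancel₀ _ d1.ne']
      field_simp
      ring
    rw [e1, e2, div_div_div_cancel_right₀ d1.ne', mul_div_mul_left _ _ d3.ne']

lemma orb_succ_pos_iff (hp : p ∈ paramDomain c) {r : ℕ} (h : orb c p r ≤ 0) :
    0 < orb c p (r + 1) ↔ 0 < p.1 + c * orb c p r := by
  rw [orb_succ_of_nonpos hp h, mobF,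
    div_pos_iff_of_pos_right (one_sub_mul_pos (neg_one_lt_snd hp) ⟨orb_ge hp r, h⟩)]

lemma Ren.fst_lt {r : ℕ} (h : Ren c r p) : (rmap c r p).1 < c⁻¹ := by
  have hc := pos_of_mem h.1
  have := (orb_succ_pos_iff h.1 h.2.1.le).1 h.2.2
  rw [rmap, div_lt_iff₀ h.1.1, ← div_eq_inv_mul, lt_div_iff₀ hc]
  linarith

lemma rmap_mem (hp : p ∈ paramDomain c) {r : ℕ} (h : orb c p r < 0)
    (h' : 0 ≤ p.1 + c * orb c p r) : rmap c r p ∈ paramDomain c⁻¹ := by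
  have hc := pos_of_mem hp
  have h0 := hp.1
  refine ⟨div_pos (neg_pos.2 h) h0, ?_, ?_⟩
  · rw [rmap, div_le_iff₀ h0, ← div_eq_inv_mul, le_div_iff₀ hc]
    linarith
  have : 0 < -orb c p r / (p.1 * c) * (c + p.1 * p.2) :=
    mul_pos (div_pos (neg_pos.2 h) (mul_pos h0 hc)) (det_pos hp)
  have e : -orb c p r / (p.1 * c) * (c + p.1 * p.2) =
      (rmap c r p).1 + (rmap c r p).2 - (c⁻¹ - 1) := by
    simp only [rmap]; field_simp; ring
  linarith

lemma Ren.rmap_mem {r : ℕ} (h : Ren c r p) : rmap c r p ∈ paramDomain c⁻¹ :=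
  BreakRenorm.rmap_mem h.1 h.2.1 ((orb_succ_pos_iff h.1 h.2.1.le).1 h.2.2).le

lemma renormEta_eq {r : ℕ} (h : Ren c r p) {z : ℝ} (hz : z ∈ Icc (-1 : ℝ) 0) :
    renormEta (mobF c p) (mobG c p) r z = mobF c⁻¹ (rmap c r p) z := by
  have hc := pos_of_mem h.1
  have h0 := h.1.1
  have hu : -(p.1 * z) ∈ Icc 0 p.1 := ⟨by nlinarith [hz.2], by nlinarith [hz.1]⟩
  have d := denom_pos h.1 ⟨orb_ge h.1 r, h.2.1.le⟩ hu
  have d' := one_sub_mul_pos (neg_one_lt_snd h.rmap_mem) hz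
  rw [renormEta, mobF_zero, iterate_mobG h.1 hu h.2.1.le]
  simp only [mobF, rmap] at d' ⊢
  have e : p.1 + ((1 - orb c p r * p.2) / c - 1) * -(p.1 * z) =
    p.1 * (1 - ((1 - orb c p r * p.2) / c - 1) * z) := by ring
  rw [e, mul_div_mul_left _ _ h0.ne', ← neg_div, div_div, mul_comm _ p.1, ← div_div]
  congr 1
  field_simp
  ring

lemma renormXi_eq {r : ℕ} (h : Ren c r p) {z : ℝ} (hz : z ∈ Icc 0 (rmap c r p).1) :
    renormXi (mobF c p) z = mobG c⁻¹ (rmap c r p) z := by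
  have hc := pos_of_mem h.1
  have h0 := h.1.1
  have hx := h.2.1
  have hz' : -(p.1 * z) ∈ Icc (-1 : ℝ) 0 := by
    obtain ⟨h1, h2⟩ := hz
    rw [rmap, le_div_iff₀ h0] at h2
    exact ⟨by nlinarith [orb_ge h.1 r], by nlinarith⟩
  have d := one_sub_mul_pos (neg_one_lt_snd h.1) hz'
  rw [renormXi, mobF_zero]
  simp only [mobF, mobG, rmap]
  have e : -orb c p r / p.1 * c⁻¹ + z * (1 + ((1 - orb c p r * p.2) / c - 1) - c⁻¹) =
      -orb c p r / (p.1 * c) * (1 - p.2 * -(p.1 * z)) := by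
    field_simp; ring
  have d' : 1 + p.1 * z * p.2 ≠ 0 := by convert d.ne' using 1; ring
  rw [e]
  rw [show 1 - p.2 * -(p.1 * z) = 1 + p.1 * z * p.2 by ring]
  have hx' := hx.ne
  field_simp
  ring

/-- The renormalization operator acts by `rmap`. -/
lemma renorm_iff {q : ℝ × ℝ} : Renorm c p q ↔ ∃ r, Ren c r p ∧ q = rmap c r p := by
  constructor
  · rintro ⟨hp, hq, r, hr, h1, h2⟩
    have hc := pos_of_mem hp
    have hr' := (hasHeight_iff hp).1 hr
    have e1 : q.1 = (rmap c r p).1 := by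
      -- The value at 0 determines a'; then a' > 0 excludes F^r(-1) = 0, which the definition of
      -- height allows.
      have := h1 (right_mem_Icc.2 (by norm_num : (-1 : ℝ) ≤ 0))
      rw [mobF_zero, renormEta, mobF_zero, mul_zero, neg_zero, mobG_zero hc.ne' hp.1.ne',
        iterate_eq_orb hp fun i hi => orb_nonpos_of_le hp hi.le hr'.1] at this
      exact this
    have hR : Ren c r p := by
      refine ⟨hp, ?_, hr'.2⟩
      have := hq.1
      rw [e1, rmap, lt_div_iff₀ hp.1] at this
      linarith
    refine ⟨r, hR, Prod.ext e1 ?_⟩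
    have hn1 : (-1 : ℝ) ∈ Icc (-1 : ℝ) 0 := by norm_num
    have := h1 hn1
    rw [renormEta_eq hR hn1, mobF_neg_one, mobF_neg_one, e1] at this
    have a1 := neg_one_lt_snd hq
    have a2 := neg_one_lt_snd hR.rmap_mem
    rw [div_eq_div_iff (by linarith) (by linarith)] at this
    -- The value at -1 is (a' - 1/c)/(1 + v'), which determines v' because a' < 1/c.
    have := mul_left_cancel₀ (by linarith [hR.fst_lt]) this
    linarith
  · rintro ⟨r, hR, rfl⟩
    exact ⟨hR.1, hR.rmap_mem, r, hR.hasHeight, fun z hz => (renormEta_eq hR hz).symm,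
      fun z hz => (renormXi_eq hR hz).symm⟩

lemma Ren.unique {r s : ℕ} (h : Ren c r p) (h' : HasHeight (mobF c p) (mobG c p) s) : r = s :=
  hasHeight_unique h.hasHeight h'

end

/-! ### The coordinate τ -/

/-- The coordinate `τ` on `D_c` for which `v = τ (c - 1)`. -/
def tau (c : ℝ) (p : ℝ × ℝ) : ℝ := p.2 / (c - 1)

section
variable {c : ℝ} {p : ℝ × ℝ}

lemma inv_ne_one_of_ne (hc1 : c ≠ 1) : c⁻¹ ≠ 1 := by simpa using hc1

lemma tau_mul (hc1 : c ≠ 1) : tau c p * (c - 1) = p.2 :=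
  div_mul_cancel₀ _ (sub_ne_zero.2 hc1)

lemma tau_mk (hc1 : c ≠ 1) (a t : ℝ) : tau c (a, t * (c - 1)) = t :=
  mul_div_cancel_right₀ _ (sub_ne_zero.2 hc1)

/-- Dividing by c - 1 absorbs the sign, so the cases c < 1 and c > 1 merge into 0 ≤ τ ≤ 1. -/
lemma mem_invDomain_iff (hc1 : c ≠ 1) :
    p ∈ invDomain c ↔ p ∈ paramDomain c ∧ 0 ≤ tau c p ∧ tau c p ≤ 1 := by
  rw [invDomain, mem_ofPred_eq, ← tau_mul hc1 (p := p)]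
  refine and_congr_right fun _ => ?_
  generalize tau c p = t
  rcases hc1.lt_or_gt with h | h
  · refine ⟨fun h' => ?_, fun h' => ⟨fun h2 => by linarith, fun _ => ?_⟩⟩
    · have := h'.2 h
      constructor <;> nlinarith
    · constructor <;> nlinarith
  · refine ⟨fun h' => ?_, fun h' => ⟨fun _ => ?_, fun h2 => by linarith⟩⟩
    · have := h'.1 h
      constructor <;> nlinarith
    · constructor <;> nlinarith

lemma tau_rmap (hc0 : 0 < c) (hc1 : c ≠ 1) (r : ℕ) :
    tau c⁻¹ (rmap c r p) = 1 + orb c p r * tau c p := by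
  have h1 : c - 1 ≠ 0 := sub_ne_zero.2 hc1
  have h2 : 1 - c ≠ 0 := sub_ne_zero.2 hc1.symm
  have h3 : c⁻¹ - 1 ≠ 0 := sub_ne_zero.2 (inv_ne_one_of_ne hc1)
  rw [tau, div_eq_iff h3, rmap, ← tau_mul hc1 (p := p)]
  field_simp
  ring

lemma dualityMap_eq (hc0 : 0 < c) (hc1 : c ≠ 1) :
    dualityMap c p = ((1 - tau c p) / (p.1 * tau c p), tau c p * (c⁻¹ - 1)) := by
  have h1 : c - 1 ≠ 0 := sub_ne_zero.2 hc1
  rw [dualityMap, ← tau_mul hc1 (p := p)]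
  ext
  · simp only
    rw [show c - 1 - tau c p * (c - 1) = (1 - tau c p) * (c - 1) by ring, ← mul_assoc,
      mul_div_mul_right _ _ h1]
  · simp only
    field_simp
    ring

lemma tau_dualityMap (hc0 : 0 < c) (hc1 : c ≠ 1) :
    tau c⁻¹ (dualityMap c p) = tau c p := by
  rw [dualityMap_eq hc0 hc1, tau_mk (inv_ne_one_of_ne hc1)]

lemma Ren.neg_one_lt {r : ℕ} (h : Ren c r p) : -1 < orb c p r := by
  have := orb_lt h.1 h.one_le h.2.1.le
  rwa [orb_zero] at this

lemma Ren.rmap_mem_invDomain {r : ℕ} (h : Ren c r p) (hc1 : c ≠ 1) (hp : p ∈ invDomain c) :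
    rmap c r p ∈ invDomain c⁻¹ ∧ 0 < tau c⁻¹ (rmap c r p) := by
  have hc := pos_of_mem h.1
  rw [mem_invDomain_iff (inv_ne_one_of_ne hc1), tau_rmap hc hc1]
  obtain ⟨_, h1, h2⟩ := (mem_invDomain_iff hc1).1 hp
  have h3 := h.neg_one_lt
  have h4 := h.2.1
  have : 0 < 1 + orb c p r * tau c p := by nlinarith
  exact ⟨⟨h.rmap_mem, this.le, by nlinarith⟩, this⟩

lemma Ren.tau_rmap_lt_one {r : ℕ} (h : Ren c r p) (hc1 : c ≠ 1) (hp : 0 < tau c p) :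
    tau c⁻¹ (rmap c r p) < 1 := by
  rw [tau_rmap (pos_of_mem h.1) hc1]
  nlinarith [h.2.1]

end

/-! ### Powers of the matrix of F and the duality relation -/

/-- Coefficients of the powers of a `2 × 2` matrix with trace `c + 1` and determinant `d`. -/
def coeffUV (c d : ℝ) : ℕ → ℝ × ℝ
  | 0 => (0, -1)
  | j + 1 => ((c + 1) * (coeffUV c d j).1 - (coeffUV c d j).2, d * (coeffUV c d j).1)

/-- Numerator of `F^j(-1)`, when `w` is the pair of coefficients of the `j`-th power. -/
def numUV (c : ℝ) (p w : ℝ × ℝ) : ℝ := w.1 * (p.1 - c) + w.2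

/-- Denominator of `F^j(-1)`, when `w` is the pair of coefficients of the `j`-th power. -/
def denUV (p w : ℝ × ℝ) : ℝ := w.1 * (1 + p.2) - w.2

section
variable {c : ℝ} {p : ℝ × ℝ}

-- By Cayley–Hamilton the j-th power of M = [[c, a], [-v, 1]] is U_j M - W_j, with (U_j, W_j) =
-- `coeffUV c d j`; it is applied to the vector (-1, 1).
lemma numUV_succ {d : ℝ} (hd : c + p.1 * p.2 = d) (j : ℕ) :
    numUV c p (coeffUV c d (j + 1)) =
      p.1 * denUV p (coeffUV c d j) + c * numUV c p (coeffUV c d j) := by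
  simp only [numUV, denUV, coeffUV, ← hd]; ring

lemma denUV_succ {d : ℝ} (hd : c + p.1 * p.2 = d) (j : ℕ) :
    denUV p (coeffUV c d (j + 1)) =
      denUV p (coeffUV c d j) - p.2 * numUV c p (coeffUV c d j) := by
  simp only [numUV, denUV, coeffUV, ← hd]; ring

lemma orb_mul_denUV {d : ℝ} (hp : p ∈ paramDomain c) (hd : c + p.1 * p.2 = d) :
    ∀ {j : ℕ}, (∀ i < j, orb c p i ≤ 0) →
      0 < denUV p (coeffUV c d j) ∧
        orb c p j * denUV p (coeffUV c d j) = numUV c p (coeffUV c d j)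
  | 0, _ => by simp [denUV, numUV, coeffUV, orb_zero]
  | j + 1, h => by
    obtain ⟨h1, h2⟩ := orb_mul_denUV hp hd (j := j) fun i hi => h i (by omega)
    have hj := h j (by omega)
    have h3 := one_sub_mul_pos (neg_one_lt_snd hp) ⟨orb_ge hp j, hj⟩
    rw [numUV_succ hd, denUV_succ hd, orb_succ_of_nonpos hp hj, ← h2]
    have e : denUV p (coeffUV c d j) - p.2 * (orb c p j * denUV p (coeffUV c d j)) =
      (1 - p.2 * orb c p j) * denUV p (coeffUV c d j) := by ring
    rw [e]
    refine ⟨mul_pos h3 h1, ?_⟩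
    rw [mobF, ← mul_assoc, div_mul_cancel₀ _ h3.ne']
    ring

lemma orb_nonpos_of_numUV {d : ℝ} (hp : p ∈ paramDomain c) (hd : c + p.1 * p.2 = d) :
    ∀ {j : ℕ}, (∀ i < j, numUV c p (coeffUV c d i) ≤ 0) → ∀ i < j, orb c p i ≤ 0
  | 0, _ => by simp
  | j + 1, h => by
    have ih := orb_nonpos_of_numUV hp hd (j := j) fun i hi => h i (by omega)
    intro i hi
    rcases (Nat.lt_succ_iff.1 hi).lt_or_eq with hi | rfl
    · exact ih i hi
    · obtain ⟨h1, h2⟩ := orb_mul_denUV hp hd ih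
      have := h i (by omega)
      rw [← h2] at this
      exact nonpos_of_mul_nonpos_left this h1

/-- Duality for the orbit of `-1`. -/
lemma Ren.dual_orb {r : ℕ} (h : Ren c r p) (hc1 : c ≠ 1) (h0 : 0 < tau c p) (h1 : tau c p < 1) :
    let q := dualityMap c⁻¹ (rmap c r p)
    q ∈ paramDomain c ∧ 0 < q.1 ∧ q.1 < c ∧
      tau c q = 1 + orb c p r * tau c p ∧ q.1 * tau c q = p.1 * tau c p ∧
      orb c q r * tau c q = tau c p - 1 := by
  intro q
  have hc := pos_of_mem h.1
  have ha := h.1.1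
  have hx0 := h.2.1
  have hx1 := h.neg_one_lt
  have hx2 : 0 < p.1 + c * orb c p r := (orb_succ_pos_iff h.1 hx0.le).1 h.2.2
  have htq : tau c q = 1 + orb c p r * tau c p := by
    have := tau_dualityMap (c := c⁻¹) (p := rmap c r p) (inv_pos.2 hc) (inv_ne_one_of_ne hc1)
    rw [inv_inv] at this
    rw [this, tau_rmap hc hc1]
  have htq0 : 0 < tau c q := by rw [htq]; nlinarith
  have htq1 : tau c q < 1 := by rw [htq]; nlinarith
  have hq1 : q.1 * tau c q = p.1 * tau c p := by
    have : q.1 = (1 - tau c q) / ((rmap c r p).1 * tau c q) := by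
      rw [htq, ← tau_rmap hc hc1]
      exact congrArg Prod.fst (dualityMap_eq (inv_pos.2 hc) (inv_ne_one_of_ne hc1))
    rw [this]
    have e : 1 - tau c q = -orb c p r * tau c p := by rw [htq]; ring
    rw [e, rmap]
    have := hx0.ne
    field_simp
  have hq0 : 0 < q.1 := pos_of_mul_pos_left (by rw [hq1]; positivity) htq0.le
  have hpv := tau_mul hc1 (p := p)
  have hqv := tau_mul hc1 (p := q)
  obtain ⟨d, hd⟩ : ∃ d, c + p.1 * p.2 = d := ⟨_, rfl⟩
  -- Equal aτ means equal determinant, so p and q share the coefficients `coeffUV c d`.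
  have hd' : c + q.1 * q.2 = d := by
    rw [← hd, ← hpv, ← hqv, ← mul_assoc, ← mul_assoc, hq1]
  have hneg : ∀ i ≤ r, orb c p i ≤ 0 := fun i hi => orb_nonpos_of_le h.1 hi hx0.le
  have key : ∀ i ≤ r, 0 < denUV p (coeffUV c d i) ∧
      orb c p i * denUV p (coeffUV c d i) = numUV c p (coeffUV c d i) := fun i hi =>
    orb_mul_denUV h.1 hd fun k hk => hneg k (by omega)
  obtain ⟨hg1, hg2, hg3⟩ := h.1
  set g := p.1 + p.2 + 1 - c with hg
  have hg0 : 0 < g := by linarith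
  have hU : ∀ i ≤ r, (coeffUV c d i).1 * g = denUV p (coeffUV c d i) * (1 + orb c p i) := by
    intro i hi
    rw [mul_add, mul_one, mul_comm _ (orb c p i), (key i hi).2, denUV, numUV]; ring
  have hUr : 0 < (coeffUV c d r).1 := by
    refine pos_of_mul_pos_left (?_ : 0 < _ * g) hg0.le
    rw [hU r le_rfl]
    exact mul_pos (key r le_rfl).1 (by linarith)
  have hUi : ∀ i ≤ r, 0 ≤ (coeffUV c d i).1 := by
    intro i hi
    refine nonneg_of_mul_nonneg_left (?_ : 0 ≤ _ * g) hg0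
    rw [hU i hi]
    exact mul_nonneg (key i hi).1.le (by linarith [orb_ge h.1 i])
  -- Up to positive factors this quantity is F^r(-1) - F^i(-1) for p. It depends only on c and d, so
  -- it can be reused for the orbit of q.
  have hW : ∀ i < r, 0 < (coeffUV c d i).1 * (coeffUV c d r).2 -
      (coeffUV c d i).2 * (coeffUV c d r).1 := by
    intro i hi
    refine pos_of_mul_pos_left (?_ : 0 < _ * g) hg0.le
    have e : ((coeffUV c d i).1 * (coeffUV c d r).2 - (coeffUV c d i).2 * (coeffUV c d r).1) * g =
        numUV c p (coeffUV c d r) * denUV p (coeffUV c d i) -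
          numUV c p (coeffUV c d i) * denUV p (coeffUV c d r) := by
      simp only [numUV, denUV, hg]; ring
    rw [e, ← (key r le_rfl).2, ← (key i hi.le).2]
    have := mul_pos (mul_pos (key i hi.le).1 (key r le_rfl).1) (sub_pos.2 (orb_lt h.1 hi hx0.le))
    linarith
  have hr := (key r le_rfl).2
  have hn : numUV c q (coeffUV c d r) * tau c q =
      (tau c p - 1) * denUV q (coeffUV c d r) := by
    have e1 : numUV c q (coeffUV c d r) * tau c q = (coeffUV c d r).1 * (p.1 * tau c p - c * tau c q)
        + (coeffUV c d r).2 * tau c q := by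
      rw [numUV, ← hq1]; ring
    rw [e1, denUV, ← hqv, htq]
    rw [numUV, denUV, ← hpv] at hr
    linear_combination (-tau c p) * hr
  have hsum : numUV c q (coeffUV c d r) + denUV q (coeffUV c d r) =
      (coeffUV c d r).1 * (q.1 + q.2 + 1 - c) := by
    rw [numUV, denUV]; ring
  have hqD : 0 < q.1 + q.2 + 1 - c := by
    refine pos_of_mul_pos_left (?_ : 0 < _ * tau c q) htq0.le
    have e : (q.1 + q.2 + 1 - c) * tau c q =
        tau c p * (p.1 + orb c p r * (c - 1) * tau c q) := by
      rw [← hqv]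
      have : 1 - tau c q = -orb c p r * tau c p := by rw [htq]; ring
      linear_combination hq1 - (c - 1) * tau c q * this
    rw [e]
    refine mul_pos h0 ?_
    rcases le_or_gt c 1 with hc' | hc'
    · have := mul_nonneg (mul_nonneg (neg_nonneg.2 hx0.le) (sub_nonneg.2 hc')) htq0.le
      nlinarith
    · have := mul_nonneg (mul_nonneg (neg_nonneg.2 hx0.le) (sub_nonneg.2 hc'.le))
        (sub_nonneg.2 htq1.le)
      nlinarith
  have hden : 0 < denUV q (coeffUV c d r) := by
    -- The factor equals τ(p)(1 + F^r(-1)), which is positive.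
    have e : denUV q (coeffUV c d r) * (tau c q - (1 - tau c p)) =
        (coeffUV c d r).1 * (q.1 + q.2 + 1 - c) * tau c q := by
      rw [← hsum, add_mul, hn]; ring
    have e' : 0 < tau c q - (1 - tau c p) := by rw [htq]; nlinarith
    refine pos_of_mul_pos_left ?_ e'.le
    rw [e]; positivity
  have hnum : numUV c q (coeffUV c d r) < 0 := by
    refine neg_of_mul_neg_left ?_ htq0.le
    rw [hn]
    exact mul_neg_of_neg_of_pos (by linarith) hden
  have hnumi : ∀ i ≤ r, numUV c q (coeffUV c d i) < 0 := by
    intro i hi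
    rcases hi.lt_or_eq with hi' | rfl
    · have e : numUV c q (coeffUV c d i) * (coeffUV c d r).1 =
          (coeffUV c d i).1 * numUV c q (coeffUV c d r) -
          ((coeffUV c d i).1 * (coeffUV c d r).2 - (coeffUV c d i).2 * (coeffUV c d r).1) := by
        simp only [numUV]; ring
      refine neg_of_mul_neg_left (?_ : _ * (coeffUV c d r).1 < 0) hUr.le
      rw [e]
      have := mul_nonneg (hUi i hi) (neg_nonneg.2 hnum.le)
      linarith [hW i hi']
    · exact hnum
  have hqc : q.1 < c := by
    have := hnumi 1 h.one_le
    simp only [numUV, coeffUV] at this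
    linarith
  have hqP : q ∈ paramDomain c := ⟨hq0, hqc.le, by linarith⟩
  have hon := orb_nonpos_of_numUV hqP hd' (j := r) fun i hi => (hnumi i hi.le).le
  refine ⟨hqP, hq0, hqc, htq, hq1, ?_⟩
  have := (orb_mul_denUV hqP hd' hon).2
  rw [← this] at hn
  refine mul_right_cancel₀ hden.ne' ?_
  linear_combination hn

/-- The first coordinate of `I_c` at the renormalization. -/
lemma Ren.dual_fst {r : ℕ} (h : Ren c r p) (hc1 : c ≠ 1) (h0 : 0 < tau c p) (h1 : tau c p < 1) :
    0 < (dualityMap c⁻¹ (rmap c r p)).1 ∧ (dualityMap c⁻¹ (rmap c r p)).1 < c :=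
  ⟨(h.dual_orb hc1 h0 h1).2.1, (h.dual_orb hc1 h0 h1).2.2.1⟩

/-- The duality map conjugates the renormalization operator to its inverse. -/
lemma Ren.dual {r : ℕ} (h : Ren c r p) (hc1 : c ≠ 1) (h0 : 0 < tau c p) (h1 : tau c p < 1)
    (hk : (dualityMap c p).1 < c⁻¹) :
    Ren c r (dualityMap c⁻¹ (rmap c r p)) ∧
      rmap c r (dualityMap c⁻¹ (rmap c r p)) = dualityMap c p ∧
      dualityMap c⁻¹ (rmap c r p) ∈ invDomain c := by
  obtain ⟨hD, hq0, hqc, ht, hq1, ho⟩ := h.dual_orb hc1 h0 h1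
  set q := dualityMap c⁻¹ (rmap c r p)
  have hc := pos_of_mem h.1
  have ha := h.1.1
  have hx0 := h.2.1
  have hx1 := h.neg_one_lt
  have ht0 : 0 < tau c q := by rw [ht]; nlinarith
  have ho' : orb c q r < 0 := by
    refine neg_of_mul_neg_left ?_ ht0.le
    rw [ho]; linarith
  rw [dualityMap_eq hc hc1] at hk ⊢
  refine ⟨⟨hD, ho', ?_⟩, ?_, ?_⟩
  · rw [orb_succ_pos_iff hD ho'.le]
    refine pos_of_mul_pos_left (?_ : 0 < _ * tau c q) ht0.le
    rw [add_mul, mul_assoc, ho, hq1]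
    simp only at hk
    rw [inv_eq_one_div, div_lt_div_iff₀ (by positivity) hc] at hk
    linarith
  · have e2 := tau_rmap (p := q) hc hc1 r
    rw [ho] at e2
    ext
    · simp only [rmap]
      rw [div_eq_div_iff hq0.ne' (by positivity), ← hq1]
      linear_combination (-q.1) * ho
    · rw [← tau_mul (inv_ne_one_of_ne hc1), e2]; ring
  · rw [mem_invDomain_iff hc1]
    exact ⟨hD, ht0.le, by rw [ht]; nlinarith⟩

/-- The duality map is an involution. -/
lemma dualityMap_dualityMap (hc0 : 0 < c) (hc1 : c ≠ 1) (ha : p.1 ≠ 0) (h0 : tau c p ≠ 0)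
    (h1 : tau c p ≠ 1) : dualityMap c⁻¹ (dualityMap c p) = p := by
  rw [dualityMap_eq (inv_pos.2 hc0) (inv_ne_one_of_ne hc1), tau_dualityMap hc0 hc1, inv_inv,
    tau_mul hc1, dualityMap_eq hc0 hc1]
  ext
  · simp only
    have : 1 - tau c p ≠ 0 := sub_ne_zero.2 h1.symm
    field_simp
  · rfl

end

/-! ### Chains of renormalizations -/

/-- The break parameter of the `n`-th renormalization. -/
def par : ℕ → ℝ → ℝ
  | 0, c => c
  | n + 1, c => par n c⁻¹

/-- The parameters of the `n`-th renormalization, when the heights are `ρ 0, ρ 1, …`. -/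
def itin : ℕ → ℝ → (ℕ → ℕ) → ℝ × ℝ → ℝ × ℝ
  | 0, _, _, p => p
  | n + 1, c, ρ, p => itin n c⁻¹ (fun i => ρ (i + 1)) (rmap c (ρ 0) p)

/-- The pair `ζ_{p,c}` is `n` times renormalizable with heights `ρ 0, …, ρ (n - 1)`. -/
def Dig : ℕ → ℝ → (ℕ → ℕ) → ℝ × ℝ → Prop
  | 0, _, _, _ => True
  | n + 1, c, ρ, p => Ren c (ρ 0) p ∧ Dig n c⁻¹ (fun i => ρ (i + 1)) (rmap c (ρ 0) p)

lemma par_inv (n : ℕ) (c : ℝ) : par n c⁻¹ = (par n c)⁻¹ := by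
  induction n generalizing c with
  | zero => rfl
  | succ n ih => exact ih c⁻¹

lemma par_succ (n : ℕ) (c : ℝ) : par (n + 1) c = (par n c)⁻¹ := par_inv n c

lemma par_two_mul_add (n i : ℕ) (c : ℝ) : par (2 * n + i) c = par i c := by
  induction n with
  | zero => simp
  | succ n ih =>
    rw [show 2 * (n + 1) + i = 2 * n + i + 1 + 1 by ring, par_succ, par_succ, inv_inv, ih]

lemma par_ne_one {c : ℝ} (hc1 : c ≠ 1) (n : ℕ) : par n c ≠ 1 := by
  induction n with
  | zero => exact hc1
  | succ n ih => rw [par_succ]; exact inv_ne_one_of_ne ih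

lemma itin_succ (n : ℕ) (c : ℝ) (ρ : ℕ → ℕ) (p : ℝ × ℝ) :
    itin (n + 1) c ρ p = rmap (par n c) (ρ n) (itin n c ρ p) := by
  induction n generalizing c ρ p with
  | zero => rfl
  | succ n ih => exact ih c⁻¹ (fun i => ρ (i + 1)) (rmap c (ρ 0) p)

lemma Dig.of_succ {n : ℕ} {c : ℝ} {ρ : ℕ → ℕ} {p : ℝ × ℝ} (h : Dig (n + 1) c ρ p) :
    Dig n c ρ p := by
  induction n generalizing c ρ p with
  | zero => trivial
  | succ n ih => exact ⟨h.1, ih h.2⟩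

lemma Dig.mono {m n : ℕ} {c : ℝ} {ρ : ℕ → ℕ} {p : ℝ × ℝ} (h : Dig n c ρ p) (hmn : m ≤ n) :
    Dig m c ρ p := by
  induction n, hmn using Nat.le_induction with
  | base => exact h
  | succ n _ ih => exact ih h.of_succ

lemma Dig.congr {n : ℕ} {c : ℝ} {ρ σ : ℕ → ℕ} {p : ℝ × ℝ} (h : Dig n c ρ p)
    (hρ : ∀ i < n, ρ i = σ i) : Dig n c σ p := by
  induction n generalizing c ρ σ p with
  | zero => trivial
  | succ n ih =>
    have h0 := hρ 0 (by omega)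
    refine ⟨h0 ▸ h.1, ?_⟩
    rw [← h0]
    exact ih h.2 fun i hi => hρ (i + 1) (by omega)

lemma itin_congr {n : ℕ} {c : ℝ} {ρ σ : ℕ → ℕ} {p : ℝ × ℝ} (hρ : ∀ i < n, ρ i = σ i) :
    itin n c ρ p = itin n c σ p := by
  induction n with
  | zero => rfl
  | succ n ih => rw [itin_succ, itin_succ, ih fun i hi => hρ i (by omega), hρ n (by omega)]

lemma Dig.ren {n : ℕ} {c : ℝ} {ρ : ℕ → ℕ} {p : ℝ × ℝ} (h : Dig n c ρ p) :
    ∀ i < n, Ren (par i c) (ρ i) (itin i c ρ p) := by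
  induction n generalizing c ρ p with
  | zero => intro i hi; omega
  | succ n ih =>
    rintro (_ | i) hi
    · exact h.1
    · exact ih h.2 i (by omega)

lemma dig_of_seq {n : ℕ} {c : ℝ} {ρ : ℕ → ℕ} {Q : ℕ → ℝ × ℝ}
    (h : ∀ i < n, Ren (par i c) (ρ i) (Q i) ∧ Q (i + 1) = rmap (par i c) (ρ i) (Q i)) :
    Dig n c ρ (Q 0) ∧ itin n c ρ (Q 0) = Q n := by
  induction n generalizing c ρ Q with
  | zero => exact ⟨trivial, rfl⟩
  | succ n ih =>
    have h0 := h 0 (by omega)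
    have := ih (c := c⁻¹) (ρ := fun i => ρ (i + 1)) (Q := fun i => Q (i + 1))
      fun i hi => h (i + 1) (by omega)
    simp only [zero_add] at this h0
    rw [h0.2] at this
    exact ⟨⟨h0.1, this.1⟩, this.2⟩

section
variable {c : ℝ} {p : ℝ × ℝ}

lemma Renorm.ren {s : ℝ × ℝ} {r : ℕ} (h : Renorm c p s)
    (hr : HasHeight (mobF c p) (mobG c p) r) : Ren c r p ∧ s = rmap c r p := by
  obtain ⟨r', h1, h2⟩ := renorm_iff.1 h
  obtain rfl := h1.unique hr
  exact ⟨h1, h2⟩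

lemma Ren.renorm {r : ℕ} (h : Ren c r p) : Renorm c p (rmap c r p) := renorm_iff.2 ⟨r, h, rfl⟩

lemma Ren.hasDigit_succ {r s n : ℕ} (h : Ren c r p) (h' : HasDigit (n + 1) c p s) :
    HasDigit n c⁻¹ (rmap c r p) s := by
  obtain ⟨q, h1, h2⟩ := h'
  rwa [(h1.ren h.hasHeight).2] at h2

/-- The last height may occur with F^r(-1) = 0, when no renormalization exists; hence one more digit
is required than is obtained. -/
lemma dig_of_hasDigit {n : ℕ} {ρ : ℕ → ℕ} (h : ∀ i < n + 1, HasDigit i c p (ρ i)) :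
    Dig n c ρ p := by
  induction n generalizing c ρ p with
  | zero => trivial
  | succ n ih =>
    obtain ⟨q, hq, _⟩ := h 1 (by omega)
    have hR := (hq.ren (h 0 (by omega)).2).1
    exact ⟨hR, ih fun i hi => hR.hasDigit_succ (h (i + 1) (by omega))⟩

lemma Dig.hasDigit {n : ℕ} {ρ : ℕ → ℕ} (h : Dig n c ρ p) : ∀ i < n, HasDigit i c p (ρ i) := by
  induction n generalizing c ρ p with
  | zero => intro i hi; omega
  | succ n ih =>
    rintro (_ | i) hi
    · exact ⟨h.1.1, h.1.hasHeight⟩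
    · exact ⟨_, h.1.renorm, ih h.2 i (by omega)⟩

lemma mem_forwardCurve_iff {r : ℤ → ℕ} :
    p ∈ forwardCurve c r ↔ p ∈ invDomain c ∧ ∀ n, Dig n c (fun i => r i) p := by
  rw [forwardCurve, mem_iInter]
  constructor
  · intro h
    refine ⟨(h 0).1, fun n => ?_⟩
    obtain ⟨_, p₀, _, h1, h2⟩ := h n
    obtain rfl : p₀ = p := h1
    refine (dig_of_hasDigit (n := 2 * n) (ρ := fun i => r i) fun i hi => ?_).mono (by omega)
    simpa using h2 i hi
  · rintro ⟨h1, h2⟩ m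
    refine ⟨h1, p, h1, rfl, fun i hi => ?_⟩
    simpa using (h2 (2 * m + 1)).hasDigit i hi

lemma renorm₂Iter_iff {k : ℕ} {ρ : ℕ → ℕ} {q : ℝ × ℝ} :
    (Renorm₂Iter c k p q ∧ ∀ i < 2 * k, HasDigit i c p (ρ i)) ↔
      Dig (2 * k) c ρ p ∧ itin (2 * k) c ρ p = q := by
  induction k generalizing p ρ with
  | zero => simp [Renorm₂Iter, Dig, itin]
  | succ k ih =>
    rw [show 2 * (k + 1) = 2 * k + 1 + 1 by ring]
    simp only [Dig, itin, inv_inv, Renorm₂Iter]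
    constructor
    · rintro ⟨⟨s, ⟨t, h1, h2⟩, h3⟩, h4⟩
      obtain ⟨R1, rfl⟩ := h1.ren (h4 0 (by omega)).2
      obtain ⟨R2, rfl⟩ := h2.ren (R1.hasDigit_succ (h4 1 (by omega))).2
      have := ih.1 ⟨h3, fun i hi => by
        have := R2.hasDigit_succ (R1.hasDigit_succ (h4 (i + 2) (by omega)))
        rwa [inv_inv] at this⟩
      exact ⟨⟨R1, R2, this.1⟩, this.2⟩
    · rintro ⟨⟨R1, R2, h3⟩, h4⟩
      obtain ⟨h5, h6⟩ := ih.2 ⟨h3, h4⟩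
      refine ⟨⟨_, ⟨_, R1.renorm, R2.renorm⟩, h5⟩, ?_⟩
      rintro (_ | _ | i) hi
      · exact ⟨R1.1, R1.hasHeight⟩
      · exact ⟨_, R1.renorm, R2.1, R2.hasHeight⟩
      · refine ⟨_, R1.renorm, _, R2.renorm, ?_⟩
        rw [inv_inv]
        exact h6 i (by omega)

lemma mem_backwardCurve_iff {r : ℤ → ℕ} :
    p ∈ backwardCurve c r ↔ p ∈ invDomain c ∧ ∀ k : ℕ, ∃ p₀ ∈ invDomain c,
      Dig (2 * k) c (fun i => r (-(2 * (k : ℤ)) + i)) p₀ ∧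
        itin (2 * k) c (fun i => r (-(2 * (k : ℤ)) + i)) p₀ = p := by
  rw [backwardCurve, mem_iInter]
  constructor
  · intro h
    refine ⟨(h 0).1, fun k => ?_⟩
    obtain ⟨_, p₀, h0, h1⟩ := h k
    exact ⟨p₀, h0, renorm₂Iter_iff.1 h1⟩
  · rintro ⟨h, h'⟩ k
    obtain ⟨p₀, h0, h1⟩ := h' k
    exact ⟨h, p₀, h0, renorm₂Iter_iff.2 h1⟩

/-! ### Reversal of chains by duality -/

/-- The part of `Δ_c` that the duality map takes to a part of `Δ_{1/c}`. -/
def Dualizable (c : ℝ) (p : ℝ × ℝ) : Prop :=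
  p ∈ invDomain c ∧ 0 < tau c p ∧ tau c p < 1 ∧ (dualityMap c p).1 < c⁻¹

lemma Ren.dualizable {r : ℕ} (h : Ren c r p) (hc1 : c ≠ 1) (hp : p ∈ invDomain c)
    (h0 : 0 < tau c p) (h1 : tau c p < 1) : Dualizable c⁻¹ (rmap c r p) := by
  obtain ⟨h2, h3⟩ := h.rmap_mem_invDomain hc1 hp
  refine ⟨h2, h3, h.tau_rmap_lt_one hc1 h0, ?_⟩
  rw [inv_inv]
  exact (h.dual_fst hc1 h0 h1).2

lemma Dualizable.dual_mem (h : Dualizable c p) (hc1 : c ≠ 1) : dualityMap c p ∈ invDomain c⁻¹ := by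
  obtain ⟨h1, h2, h3, h4⟩ := h
  have hp := ((mem_invDomain_iff hc1).1 h1).1
  have hc := pos_of_mem hp
  rw [mem_invDomain_iff (inv_ne_one_of_ne hc1), tau_dualityMap hc hc1]
  refine ⟨⟨?_, h4.le, ?_⟩, h2.le, h3.le⟩
  · rw [dualityMap_eq hc hc1]
    exact div_pos (by linarith) (mul_pos hp.1 h2)
  · rw [dualityMap_eq hc hc1]
    have ha := hp.1
    have hd := det_pos hp
    rw [← tau_mul hc1 (p := p)] at hd
    have h5 : 0 < 1 - tau c p := by linarith
    have e : (1 - tau c p) / (p.1 * tau c p) + tau c p * (c⁻¹ - 1) - (c⁻¹ - 1) =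
        (1 - tau c p) * (c + p.1 * (tau c p * (c - 1))) / (p.1 * tau c p * c) := by
      field_simp
      ring
    have : 0 < (1 - tau c p) * (c + p.1 * (tau c p * (c - 1))) / (p.1 * tau c p * c) := by
      positivity
    simp only
    linarith

/-- The duality map reverses chains of renormalizations. -/
lemma dig_reverse {n : ℕ} {ρ : ℕ → ℕ} {P : ℕ → ℝ × ℝ} (hc1 : c ≠ 1)
    (hP : ∀ i < 2 * n, Ren (par i c) (ρ i) (P i) ∧ P (i + 1) = rmap (par i c) (ρ i) (P i))
    (h0 : Dualizable c (P 0)) :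
    Dig (2 * n) c⁻¹ (fun i => ρ (2 * n - 1 - i)) (dualityMap c (P (2 * n))) ∧
      itin (2 * n) c⁻¹ (fun i => ρ (2 * n - 1 - i)) (dualityMap c (P (2 * n))) =
        dualityMap c (P 0) ∧ Dualizable c (P (2 * n)) := by
  have hd : ∀ i ≤ 2 * n, Dualizable (par i c) (P i) := by
    intro i
    induction i with
    | zero => intro _; exact h0
    | succ i ih =>
      intro hi
      obtain ⟨h1, h2⟩ := hP i (by omega)
      obtain ⟨h3, h4, h5, _⟩ := ih (by omega)
      rw [par_succ, h2]
      exact h1.dualizable (par_ne_one hc1 i) h3 h4 h5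
  have key := dig_of_seq (n := 2 * n) (c := c⁻¹) (ρ := fun i => ρ (2 * n - 1 - i))
    (Q := fun i => dualityMap (par (2 * n - i) c) (P (2 * n - i))) (fun i hi => by
      obtain ⟨h1, h2⟩ := hP (2 * n - 1 - i) (by omega)
      obtain ⟨h3, h4, h5, h6⟩ := hd (2 * n - 1 - i) (by omega)
      have e1 : 2 * n - i = 2 * n - 1 - i + 1 := by omega
      have e2 : 2 * n - (i + 1) = 2 * n - 1 - i := by omega
      -- The indices i and 2n - 1 - i have opposite parity, so their break parameters are
      -- reciprocal.
      have e3 : par i c⁻¹ = par (2 * n - 1 - i) c := by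
        have : par (2 * i + (2 * n - 1 - i)) c = par (2 * (n - 1) + (i + 1)) c := by
          congr 1; omega
        rw [par_two_mul_add, par_two_mul_add] at this
        exact this.symm
      obtain ⟨d1, d2, -⟩ := h1.dual (par_ne_one hc1 _) h4 h5 h6
      rw [e1, e2, e3, h2, par_succ]
      exact ⟨d1, d2.symm⟩)
  simp only [Nat.sub_zero, Nat.sub_self] at key
  have e : par (2 * n) c = c := par_two_mul_add n 0 c
  rw [e] at key
  refine ⟨key.1, key.2, ?_⟩
  have := hd (2 * n) le_rfl
  rwa [e] at this

/-- One step gives τ > 0, a second gives τ < 1, and a third gives the bound on the first coordinate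
of the dual point. The fourth only restores the break parameter c. -/
lemma dualizable_itin_four {ρ : ℕ → ℕ} (hc1 : c ≠ 1) (hp : p ∈ invDomain c) (h : Dig 4 c ρ p) :
    Dualizable c (itin 4 c ρ p) := by
  obtain ⟨R0, R1, R2, R3, -⟩ := h
  have hc1' := inv_ne_one_of_ne hc1
  simp only [inv_inv] at R2 R3
  simp only [itin, inv_inv]
  obtain ⟨a1, b1⟩ := R0.rmap_mem_invDomain hc1 hp
  obtain ⟨a2, b2⟩ := R1.rmap_mem_invDomain hc1' a1
  have c2 := R1.tau_rmap_lt_one hc1' b1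
  rw [inv_inv] at a2 b2 c2
  obtain ⟨a3, b3, c3, -⟩ := R2.dualizable hc1 a2 b2 c2
  have := R3.dualizable hc1' a3 b3 c3
  rwa [inv_inv] at this

lemma mem_dualityDomain_iff (hc0 : 0 < c) (hc1 : c ≠ 1) (hp : p ∈ invDomain c) :
    p ∈ dualityDomain c ↔ Dualizable c p := by
  obtain ⟨hD, h0, h1⟩ := (mem_invDomain_iff hc1).1 hp
  constructor
  · rintro ⟨-, h2, h3, h4⟩
    have t0 : tau c p ≠ 0 := fun h => h2 (by rw [← tau_mul hc1 (p := p), h, zero_mul])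
    have t1 : tau c p ≠ 1 := fun h => by
      have := h3.1
      rw [dualityMap_eq hc0 hc1, h] at this
      simp at this
    exact ⟨hp, lt_of_le_of_ne h0 t0.symm, lt_of_le_of_ne h1 t1, lt_of_le_of_ne h3.2.1 h4⟩
  · intro h
    refine ⟨hD, ?_, (h.dual_mem hc1).1, h.2.2.2.ne⟩
    rw [← tau_mul hc1 (p := p)]
    exact mul_ne_zero h.2.1.ne' (sub_ne_zero.2 hc1)

/-- Both inclusions apply `dig_reverse`: the dual of the end of a chain starts the chain with the
heights in reverse order. -/
theorem backwardCurve_eq (hc0 : 0 < c) (hc1 : c ≠ 1) (r : ℤ → ℕ) :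
    backwardCurve c⁻¹ r =
      dualityMap c '' (forwardCurve c (fun i => r (-1 - i)) ∩ dualityDomain c) := by
  have hc0' := inv_pos.2 hc0
  have hc1' := inv_ne_one_of_ne hc1
  ext q
  constructor
  · intro hq
    obtain ⟨hq1, hq2⟩ := mem_backwardCurve_iff.1 hq
    have key : ∀ n : ℕ, Dig (2 * n) c (fun i => r (-1 - i)) (dualityMap c⁻¹ q) ∧
        Dualizable c⁻¹ q ∧ q.1 < c⁻¹ := by
      intro n
      -- Two extra steps of the past are requested, since the first four renormalizations only serve
      -- to reach the dualizable region.
      obtain ⟨p₀, h0, h1, h2⟩ := hq2 (n + 2)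
      set ρ : ℕ → ℕ := fun i => r (-(2 * ((n + 2 : ℕ) : ℤ)) + i) with hρ
      have h3 := dig_reverse (n := n) (c := c⁻¹) (ρ := fun i => ρ (i + 4))
        (P := fun i => itin (i + 4) c⁻¹ ρ p₀) hc1' (fun i hi => by
          have e : par (i + 4) c⁻¹ = par i c⁻¹ := by
            rw [show i + 4 = 2 * 2 + i by ring, par_two_mul_add]
          have := h1.ren (i + 4) (by omega)
          rw [e] at this
          refine ⟨this, ?_⟩
          rw [show i + 1 + 4 = i + 4 + 1 by ring, itin_succ, e])
        (dualizable_itin_four hc1' h0 (h1.mono (by omega)))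
      simp only [inv_inv, show 2 * n + 4 = 2 * (n + 2) by ring, h2] at h3
      refine ⟨h3.1.congr fun i hi => ?_, h3.2.2, ?_⟩
      · simp only [hρ]
        congr 1
        push_cast [show i + 1 ≤ 2 * n by omega]
        omega
      -- A point obtained by renormalization has first coordinate strictly below its bound; this
      -- puts its dual in the domain of I.
      · have e : par (2 * n + 3) c⁻¹ = c := by
          rw [par_two_mul_add]; simp [par]
        have := (h1.ren (2 * n + 3) (by omega)).fst_lt
        rw [← itin_succ, show 2 * n + 3 + 1 = 2 * (n + 2) by ring, h2, e] at this
        exact this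
    obtain ⟨-, hq3, hq4⟩ := key 0
    have hp := hq3.dual_mem hc1'
    rw [inv_inv] at hp
    have hI : dualityMap c (dualityMap c⁻¹ q) = q := by
      have := dualityMap_dualityMap hc0' hc1' hq1.1.1.ne' hq3.2.1.ne' hq3.2.2.1.ne
      rwa [inv_inv] at this
    have ht : tau c (dualityMap c⁻¹ q) = tau c⁻¹ q := by
      have := tau_dualityMap (p := q) hc0' hc1'
      rwa [inv_inv] at this
    refine ⟨dualityMap c⁻¹ q, ⟨mem_forwardCurve_iff.2 ⟨hp, fun n => ?_⟩, ?_⟩, hI⟩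
    · exact (key n).1.mono (by omega)
    · rw [mem_dualityDomain_iff hc0 hc1 hp, Dualizable, ht, hI]
      exact ⟨hp, hq3.2.1, hq3.2.2.1, hq4⟩
  · rintro ⟨p, ⟨hp, hpE⟩, rfl⟩
    obtain ⟨hp1, hp2⟩ := mem_forwardCurve_iff.1 hp
    have hD := (mem_dualityDomain_iff hc0 hc1 hp1).1 hpE
    refine mem_backwardCurve_iff.2 ⟨hD.dual_mem hc1, fun k => ?_⟩
    obtain ⟨h1, h2, h3⟩ := dig_reverse (n := k) (P := fun i => itin i c (fun i => r (-1 - i)) p)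
      (ρ := fun i => r (-1 - i)) hc1
      (fun i hi => ⟨(hp2 (2 * k)).ren i hi, itin_succ _ _ _ _⟩) hD
    have e : ∀ i < 2 * k, (fun i : ℕ => r (-1 - ((2 * k - 1 - i : ℕ) : ℤ))) i =
        (fun i : ℕ => r (-(2 * (k : ℤ)) + i)) i := by
      intro i hi
      have : -1 - ((2 * k - 1 - i : ℕ) : ℤ) = -(2 * (k : ℤ)) + i := by omega
      exact congrArg r this
    refine ⟨_, h3.dual_mem hc1, h1.congr e, ?_⟩
    rw [← itin_congr e, h2]
    rfl

end

/-! ### Limits of pairs with prescribed heights -/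

open Filter Topology

section
variable {c : ℝ} {p : ℝ × ℝ}

lemma continuous_clamp : Continuous clamp :=
  continuous_const.max (continuous_id.min continuous_const)

lemma continuousAt_orb (hp : -1 < p.2) : ∀ j, ContinuousAt (fun q => orb c q j) p
  | 0 => continuousAt_const
  | j + 1 => by
    have ih := continuous_clamp.continuousAt.comp (continuousAt_orb hp j)
    simp only [orb_succ, mobF]
    refine ContinuousAt.div (continuousAt_fst.add (continuousAt_const.mul ih))
      (continuousAt_const.sub (continuousAt_snd.mul ih)) ?_
    exact (one_sub_mul_pos hp (clamp_mem _)).ne'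

lemma continuousAt_rmap (r : ℕ) (hp : -1 < p.2) (h0 : p.1 ≠ 0) :
    ContinuousAt (rmap c r) p := by
  have h := continuousAt_orb (c := c) hp r
  exact (h.neg.div continuousAt_fst h0).prodMk
    (((continuousAt_const.sub (h.mul continuousAt_snd)).div_const c).sub continuousAt_const)

lemma orb_neg_of_fst_eq_zero (hc0 : 0 < c) (hp : -1 < p.2) (h0 : p.1 = 0) :
    ∀ j, orb c p j < 0
  | 0 => by rw [orb_zero]; norm_num
  | j + 1 => by
    have ih := orb_neg_of_fst_eq_zero hc0 hp h0 j
    have hcl : clamp (orb c p j) < 0 := max_lt (by norm_num) (min_lt_of_left_lt ih)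
    rw [orb_succ, mobF, h0, zero_add]
    exact div_neg_of_neg_of_pos (mul_neg_of_pos_of_neg hc0 hcl)
      (one_sub_mul_pos hp (clamp_mem _))

lemma neg_one_lt_of_tau (hc0 : 0 < c) (hc1 : c ≠ 1) (h0 : 0 ≤ tau c p) (h1 : tau c p ≤ 1) :
    -1 < p.2 := by
  rw [← tau_mul hc1 (p := p)]
  rcases h0.eq_or_lt with h | h
  · rw [← h]; norm_num
  · nlinarith [mul_pos h hc0]

/-- At a = 0 the map F fixes 0, so the orbit of -1 stays negative; in the limit this contradicts
F^(r+1)(-1) ≥ 0. -/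
lemma fst_pos_of_tendsto {ι : Type*} {l : Filter ι} [l.NeBot] {P : ι → ℝ × ℝ} {r : ℕ}
    (hc0 : 0 < c) (h : Tendsto P l (𝓝 p)) (hp : -1 < p.2) (hP : ∀ᶠ i in l, Ren c r (P i)) :
    0 < p.1 := by
  have h1 : 0 ≤ orb c p (r + 1) :=
    ge_of_tendsto ((continuousAt_orb hp _).tendsto.comp h) (hP.mono fun i hi => hi.2.2.le)
  have h2 : 0 ≤ p.1 :=
    ge_of_tendsto ((continuous_fst.tendsto p).comp h) (hP.mono fun i hi => hi.1.1.le)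
  refine lt_of_le_of_ne h2 fun h0 => ?_
  exact absurd (orb_neg_of_fst_eq_zero hc0 hp h0.symm (r + 1)) (not_lt.2 h1)

/-- Two further heights exclude the degenerate limits. F^r(-1) = 0 would make the first
renormalization have a = 0. F^(r+1)(-1) = 0 would make its first coordinate 1/c; its orbit then
reaches 0 after one step, and the second renormalization has a = 0. -/
lemma ren_of_tendsto {ι : Type*} {l : Filter ι} [l.NeBot] {P : ι → ℝ × ℝ} {r s t : ℕ}
    (hc1 : c ≠ 1) (h : Tendsto P l (𝓝 p)) (hp : p ∈ invDomain c)
    (h1 : ∀ᶠ i in l, Ren c r (P i)) (h2 : ∀ᶠ i in l, Ren c⁻¹ s (rmap c r (P i)))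
    (h3 : ∀ᶠ i in l, Ren c t (rmap c⁻¹ s (rmap c r (P i)))) : Ren c r p := by
  obtain ⟨hD, t0, t1⟩ := (mem_invDomain_iff hc1).1 hp
  have hc0 := pos_of_mem hD
  have hc0' := inv_pos.2 hc0
  have hc1' := inv_ne_one_of_ne hc1
  have a0 := hD.1
  have ho := (continuousAt_orb (c := c) (neg_one_lt_snd hD) r).tendsto.comp h
  have hq := (continuousAt_rmap (c := c) r (neg_one_lt_snd hD) a0.ne').tendsto.comp h
  have x0 : orb c p r ≤ 0 := le_of_tendsto ho (h1.mono fun i hi => hi.2.1.le)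
  have x1 := orb_ge hD r
  have hv : -1 < (rmap c r p).2 := by
    refine neg_one_lt_of_tau hc0' hc1' ?_ ?_ <;> rw [tau_rmap hc0 hc1] <;> nlinarith
  have a1 := fst_pos_of_tendsto hc0' hq hv h2
  have ho' := (continuousAt_orb (c := c⁻¹) hv s).tendsto.comp hq
  have ho'' := (continuousAt_orb (c := c⁻¹) hv 1).tendsto.comp hq
  have y0 : orb c⁻¹ (rmap c r p) s ≤ 0 := le_of_tendsto ho' (h2.mono fun i hi => hi.2.1.le)
  have y1 : -1 ≤ orb c⁻¹ (rmap c r p) s :=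
    ge_of_tendsto ho' (h2.mono fun i hi => orb_ge hi.1 s)
  have y2 : orb c⁻¹ (rmap c r p) 1 ≤ orb c⁻¹ (rmap c r p) s :=
    le_of_tendsto_of_tendsto ho'' ho' (h2.mono fun i hi => orb_le hi.1 hi.one_le hi.2.1.le)
  have hq' := (continuousAt_rmap (c := c⁻¹) s hv a1.ne').tendsto.comp hq
  have hv' : -1 < (rmap c⁻¹ s (rmap c r p)).2 := by
    have e := tau_rmap (p := rmap c r p) hc0' hc1' s
    rw [inv_inv, tau_rmap hc0 hc1] at e
    have z0 : 0 ≤ 1 + orb c p r * tau c p := by nlinarith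
    have z1 : 1 + orb c p r * tau c p ≤ 1 := by nlinarith
    refine neg_one_lt_of_tau hc0 hc1 ?_ ?_ <;> rw [e] <;> nlinarith
  have a2 := fst_pos_of_tendsto hc0 hq' hv' h3
  have hx : orb c p r < 0 := by
    rw [rmap, lt_div_iff₀ a0] at a1
    linarith
  refine ⟨hD, hx, ?_⟩
  have hy : orb c⁻¹ (rmap c r p) 1 < 0 := by
    rw [rmap, lt_div_iff₀ a1] at a2
    linarith
  rw [orb_one, div_neg_iff] at hy
  have hlt : (rmap c r p).1 < c⁻¹ := by
    rcases hy with hy | hy <;> linarith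
  rw [rmap, div_lt_iff₀ a0, ← div_eq_inv_mul, lt_div_iff₀ hc0] at hlt
  rw [orb_succ_pos_iff hD x0]
  linarith

/-- The set of pairs with given heights is closed, up to the last three heights. -/
lemma dig_of_tendsto {ι : Type*} {l : Filter ι} [l.NeBot] {n : ℕ} {ρ : ℕ → ℕ} {P : ι → ℝ × ℝ}
    (hc1 : c ≠ 1) (h : Tendsto P l (𝓝 p)) (hp : p ∈ invDomain c)
    (hP : ∀ᶠ i in l, Dig (n + 3) c ρ (P i)) : Dig n c ρ p := by
  induction n generalizing c ρ P p with
  | zero => trivial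
  | succ n ih =>
    have h1 : Ren c (ρ 0) p := by
      refine ren_of_tendsto hc1 h hp (hP.mono fun i hi => hi.1) (hP.mono fun i hi => hi.2.1)
        (t := ρ 2) (hP.mono fun i hi => ?_)
      have := hi.2.2.1
      rwa [inv_inv] at this
    refine ⟨h1, ih (inv_ne_one_of_ne hc1) ?_ (h1.rmap_mem_invDomain hc1 hp).1
      (hP.mono fun i hi => hi.2)⟩
    exact (continuousAt_rmap _ (neg_one_lt_snd h1.1) h1.1.1.ne').tendsto.comp h

/-! ### Existence of pairs with finitely many given heights -/

lemma exists_first_zero {f : ℝ → ℝ} {α β : ℝ} (hαβ : α ≤ β) (hf : ContinuousOn f (Icc α β))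
    (hα : f α < 0) (hβ : 0 ≤ f β) : ∃ t ∈ Icc α β, f t = 0 ∧ ∀ s ∈ Ico α t, f s < 0 := by
  have hS : IsCompact (Icc α β ∩ f ⁻¹' Ici 0) :=
    isCompact_Icc.of_isClosed_subset (hf.preimage_isClosed_of_isClosed isClosed_Icc isClosed_Ici)
      inter_subset_left
  obtain ⟨t, ⟨ht1, ht2⟩, ht3⟩ := hS.exists_isLeast ⟨β, right_mem_Icc.2 hαβ, hβ⟩
  have hneg : ∀ s ∈ Ico α t, f s < 0 := by
    intro s hs
    by_contra! h
    exact absurd (ht3 ⟨⟨hs.1, hs.2.le.trans ht1.2⟩, h⟩) (not_le.2 hs.2)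
  refine ⟨t, ht1, ?_, hneg⟩
  obtain ⟨s, hs, hs0⟩ := intermediate_value_Icc ht1.1 (hf.mono (Icc_subset_Icc_right ht1.2))
    ⟨hα.le, ht2⟩
  rcases hs.2.eq_or_lt with rfl | h
  · exact hs0
  · exact absurd hs0 (hneg s ⟨hs.1, h⟩).ne

lemma exists_last_zero {f : ℝ → ℝ} {α β : ℝ} (hαβ : α ≤ β) (hf : ContinuousOn f (Icc α β))
    (hα : f α ≤ 0) (hβ : 0 < f β) : ∃ t ∈ Icc α β, f t = 0 ∧ ∀ s ∈ Ioc t β, 0 < f s := by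
  have hg : ContinuousOn (fun s => -f (-s)) (Icc (-β) (-α)) := by
    refine (hf.comp continuousOn_neg fun s hs => ?_).neg
    exact ⟨by linarith [hs.2], by linarith [hs.1]⟩
  obtain ⟨t, ht1, ht2, ht3⟩ := exists_first_zero (neg_le_neg hαβ) hg (by simpa using hβ)
    (by simpa using hα)
  refine ⟨-t, ⟨by linarith [ht1.2], by linarith [ht1.1]⟩, by linarith, fun s hs => ?_⟩
  have := ht3 (-s) ⟨by linarith [hs.2], by linarith [hs.1]⟩
  rw [neg_neg] at this
  linarith

/-- A curve of parameters from `a = 0` to `a = c` contains pairs with any given heights. -/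
lemma exists_dig {n : ℕ} {ρ : ℕ → ℕ} (hρ : ∀ i, 1 ≤ ρ i) (hc0 : 0 < c) (hc1 : c ≠ 1)
    {γ : ℝ → ℝ × ℝ} {α β : ℝ} (hαβ : α ≤ β) (hγ : ContinuousOn γ (Icc α β))
    (hmem : ∀ t ∈ Icc α β, 0 ≤ (γ t).1 ∧ (0 < (γ t).1 → γ t ∈ paramDomain c) ∧
      0 ≤ tau c (γ t) ∧ tau c (γ t) ≤ 1)
    (hα : (γ α).1 = 0) (hβ : (γ β).1 = c) :
    ∃ t ∈ Icc α β, 0 < (γ t).1 ∧ (γ t).1 < c ∧ Dig n c ρ (γ t) := by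
  induction n generalizing c ρ γ α β with
  | zero =>
    obtain ⟨t, ht, ht'⟩ := intermediate_value_Icc hαβ (continuous_fst.comp_continuousOn hγ)
      (show c / 2 ∈ Icc (γ α).1 (γ β).1 by rw [hα, hβ]; constructor <;> linarith)
    have e : (γ t).1 = c / 2 := ht'
    exact ⟨t, ht, by linarith, by linarith, trivial⟩
  | succ n ih =>
    have hv : ∀ t ∈ Icc α β, -1 < (γ t).2 := fun t ht =>
      neg_one_lt_of_tau hc0 hc1 (hmem t ht).2.2.1 (hmem t ht).2.2.2
    have hcont : ∀ j, ContinuousOn (fun t => orb c (γ t) j) (Icc α β) := fun j t ht =>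
      (continuousAt_orb (hv t ht) j).comp_continuousWithinAt (hγ t ht)
    have hpos : ∀ t ∈ Icc α β, ∀ j, 0 ≤ orb c (γ t) j → 0 < (γ t).1 := fun t ht j hj =>
      lt_of_le_of_ne (hmem t ht).1 fun h0 =>
        absurd (orb_neg_of_fst_eq_zero hc0 (hv t ht) h0.symm j) (not_lt.2 hj)
    have hαI := left_mem_Icc.2 hαβ
    have hβI := right_mem_Icc.2 hαβ
    -- At a = c one has F(-1) = 0, so the orbit cannot be negative at any index ≥ 1.
    have hc : ∀ t ∈ Icc α β, orb c (γ t) (ρ 0) < 0 → (γ t).1 ≠ c := by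
      intro t ht h0 h
      have hD := (hmem t ht).2.1 (h ▸ hc0)
      have := orb_le hD (hρ 0) h0.le
      rw [orb_one, h, sub_self, zero_div] at this
      linarith
    obtain ⟨t₂, ht₂, u0, hu⟩ := exists_first_zero hαβ (hcont (ρ 0))
      (orb_neg_of_fst_eq_zero hc0 (hv α hαI) hα _) (not_lt.1 fun h => hc β hβI h hβ)
    have hsub₂ : Icc α t₂ ⊆ Icc α β := Icc_subset_Icc_right ht₂.2
    have w0 : 0 < orb c (γ t₂) (ρ 0 + 1) := by
      rw [orb_succ, u0, clamp_of_nonneg le_rfl, mobF_zero]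
      exact hpos t₂ ht₂ _ u0.ge
    obtain ⟨t₁, ht₁, w1, hw⟩ := exists_last_zero ht₂.1 ((hcont (ρ 0 + 1)).mono hsub₂)
      (orb_neg_of_fst_eq_zero hc0 (hv α hαI) hα _).le w0
    have hI : ∀ t ∈ Icc t₁ t₂, t ∈ Icc α β ∧ γ t ∈ paramDomain c ∧
        orb c (γ t) (ρ 0) ≤ 0 ∧ 0 ≤ (γ t).1 + c * orb c (γ t) (ρ 0) := by
      intro t ht
      have h1 : t ∈ Icc α β := ⟨ht₁.1.trans ht.1, ht.2.trans ht₂.2⟩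
      have h2 : 0 ≤ orb c (γ t) (ρ 0 + 1) := by
        rcases ht.1.eq_or_lt with rfl | h
        · exact w1.ge
        · exact (hw t ⟨h, ht.2⟩).le
      have h3 := (hmem t h1).2.1 (hpos t h1 _ h2)
      have h4 : orb c (γ t) (ρ 0) ≤ 0 := by
        rcases ht.2.eq_or_lt with rfl | h
        · exact u0.le
        · exact (hu t ⟨h1.1, h⟩).le
      refine ⟨h1, h3, h4, ?_⟩
      rw [orb_succ_of_nonpos h3 h4, mobF] at h2
      have h5 := one_sub_mul_pos (neg_one_lt_snd h3) ⟨orb_ge h3 (ρ 0), h4⟩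
      have := mul_nonneg h2 h5.le
      rwa [div_mul_cancel₀ _ h5.ne'] at this
    -- The renormalized arc has first coordinate 1/c at t₁ and 0 at t₂, so the parameter is negated
    -- to recover the orientation that the induction needs.
    have hneg : ∀ s ∈ Icc (-t₂) (-t₁), -s ∈ Icc t₁ t₂ := fun s hs =>
      ⟨by linarith [hs.2], by linarith [hs.1]⟩
    obtain ⟨s, hs, s0, s1, hdig⟩ := ih (c := c⁻¹) (ρ := fun i => ρ (i + 1))
      (γ := fun s => rmap c (ρ 0) (γ (-s))) (fun i => hρ (i + 1)) (inv_pos.2 hc0)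
      (inv_ne_one_of_ne hc1) (neg_le_neg ht₁.2)
      (fun s hs => by
        obtain ⟨h1, h2, -⟩ := hI _ (hneg s hs)
        refine ContinuousAt.comp_continuousWithinAt (f := fun s => γ (-s))
          (continuousAt_rmap _ (hv _ h1) h2.1.ne') ?_
        exact (hγ _ h1).comp continuousWithinAt_neg fun s hs => (hI _ (hneg s hs)).1)
      (fun s hs => by
        obtain ⟨h1, h2, h3, h4⟩ := hI _ (hneg s hs)
        have h5 := orb_ge h2 (ρ 0)
        obtain ⟨-, -, h6, h7⟩ := hmem _ h1
        refine ⟨div_nonneg (neg_nonneg.2 h3) h2.1.le, fun h => rmap_mem h2 ?_ h4, ?_, ?_⟩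
        · simp only [rmap] at h
          rw [lt_div_iff₀ h2.1] at h
          linarith
        · rw [tau_rmap hc0 hc1]; nlinarith
        · rw [tau_rmap hc0 hc1]; nlinarith)
      (by simp only [rmap, neg_neg, u0, neg_zero, zero_div])
      (by
        obtain ⟨h1, h2, h3, h4⟩ := hI t₁ (left_mem_Icc.2 ht₁.2)
        simp only [rmap, neg_neg]
        have := h2.1
        rw [div_eq_iff this.ne', ← div_eq_inv_mul, eq_div_iff hc0.ne']
        have h6 := mt (orb_succ_pos_iff h2 h3).2 (by rw [w1]; exact lt_irrefl 0)
        linarith)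
    obtain ⟨h1, h2, h3, h4⟩ := hI _ (hneg s hs)
    have a0 := h2.1
    have h5 : orb c (γ (-s)) (ρ 0) < 0 := by
      simp only [rmap] at s0
      rw [lt_div_iff₀ a0] at s0
      linarith
    refine ⟨-s, h1, a0, lt_of_le_of_ne h2.2.1 (hc _ h1 h5), ⟨h2, h5, ?_⟩, hdig⟩
    simp only [rmap] at s1
    rw [div_lt_iff₀ a0, ← div_eq_inv_mul, lt_div_iff₀ hc0] at s1
    rw [orb_succ_pos_iff h2 h3]
    linarith

end

/-! ### Preimages of vertical lines under the duality map -/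

/-- The point with first coordinate `a` of the curve that the duality map takes to a part of a
vertical line with first coordinate `κ`. -/
def dualLine (c κ a : ℝ) : ℝ × ℝ := (a, 1 / (1 + a * κ) * (c - 1))

section
variable {c κ a : ℝ}

lemma tau_dualLine (hc1 : c ≠ 1) : tau c (dualLine c κ a) = 1 / (1 + a * κ) := tau_mk hc1 _ _

lemma tau_dualLine_mem (hc1 : c ≠ 1) (hκ : 0 ≤ κ) (ha : 0 ≤ a) :
    0 < tau c (dualLine c κ a) ∧ tau c (dualLine c κ a) ≤ 1 := by
  rw [tau_dualLine hc1]
  have : 0 ≤ a * κ := mul_nonneg ha hκ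
  exact ⟨by positivity, by rw [div_le_one (by positivity)]; linarith⟩

lemma dualLine_mem (hc0 : 0 < c) (hc1 : c ≠ 1) (hκ : κ ∈ Ioo 0 c⁻¹) (ha : a ∈ Ioc 0 c) :
    dualLine c κ a ∈ invDomain c := by
  obtain ⟨h1, h2⟩ := tau_dualLine_mem hc1 hκ.1.le ha.1.le
  refine (mem_invDomain_iff hc1).2 ⟨⟨ha.1, ha.2, ?_⟩, h1.le, h2⟩
  have hk : κ * c < 1 := by
    have := hκ.2
    rwa [inv_eq_one_div, lt_div_iff₀ hc0] at this
  have h3 : 0 < a * κ := mul_pos ha.1 hκ.1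
  have e : a + 1 / (1 + a * κ) * (c - 1) - (c - 1) = a * (1 + a * κ - κ * c + κ) / (1 + a * κ) := by
    field_simp; ring
  have : 0 < a * (1 + a * κ - κ * c + κ) / (1 + a * κ) :=
    div_pos (mul_pos ha.1 (by linarith [hκ.1])) (by positivity)
  simp only [dualLine]
  linarith

lemma dualityMap_dualLine (hc0 : 0 < c) (hc1 : c ≠ 1) (hκ : 0 < κ) (ha : 0 < a) :
    dualityMap c (dualLine c κ a) = (κ, 1 / (1 + a * κ) * (c⁻¹ - 1)) := by
  have : 0 < 1 + a * κ := by positivity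
  rw [dualityMap_eq hc0 hc1, tau_dualLine hc1]
  ext
  · simp only [dualLine]; field_simp; ring
  · rfl

lemma eq_dualLine {p : ℝ × ℝ} (hc0 : 0 < c) (hc1 : c ≠ 1) (h0 : 0 < tau c p) (ha : 0 < p.1) :
    p = dualLine c (dualityMap c p).1 p.1 := by
  rw [dualityMap_eq hc0 hc1]
  ext
  · rfl
  · simp only [dualLine]
    rw [← tau_mul hc1 (p := p)]
    congr 1
    field_simp
    ring

lemma continuousAt_dualLine (hκ : 0 ≤ κ) (ha : 0 ≤ a) :
    ContinuousAt (fun x : ℝ × ℝ => dualLine c x.1 x.2) (κ, a) := by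
  have : 1 + a * κ ≠ 0 := by positivity
  exact continuousAt_snd.prodMk ((continuousAt_const.div
    (continuousAt_const.add (continuousAt_snd.mul continuousAt_fst)) this).mul continuousAt_const)

/-- A limit of points with given heights. -/
lemma dualLine_limit {ι : Type*} {l : Filter ι} [l.NeBot] {ρ : ℕ → ℕ} {K A : ι → ℝ}
    (hc0 : 0 < c) (hc1 : c ≠ 1) (hκ : κ ∈ Ioo 0 c⁻¹) (ha : a ∈ Icc 0 c)
    (hK : Tendsto K l (𝓝 κ)) (hA : Tendsto A l (𝓝 a))
    (h : ∀ n, ∀ᶠ i in l, Dig n c ρ (dualLine c (K i) (A i))) :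
    a ∈ Ioc 0 c ∧ ∀ n, Dig n c ρ (dualLine c κ a) := by
  have ht : Tendsto (fun i => dualLine c (K i) (A i)) l (𝓝 (dualLine c κ a)) :=
    (continuousAt_dualLine (c := c) hκ.1.le ha.1).tendsto.comp (hK.prodMk_nhds hA)
  obtain ⟨h1, h2⟩ := tau_dualLine_mem hc1 hκ.1.le ha.1
  have ha' : a ∈ Ioc 0 c := ⟨fst_pos_of_tendsto hc0 ht (neg_one_lt_of_tau hc0 hc1 h1.le h2)
    ((h 1).mono fun i hi => hi.1), ha.2⟩
  exact ⟨ha', fun n => dig_of_tendsto hc1 ht (dualLine_mem hc0 hc1 hκ ha') (h (n + 3))⟩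

/-- Points realizing the first n heights accumulate by compactness. Since `Dig` is closed up to
losing three heights, the limit realizes all of them. -/
lemma exists_dualLine {ρ : ℕ → ℕ} (hρ : ∀ i, 1 ≤ ρ i) (hc0 : 0 < c) (hc1 : c ≠ 1)
    (hκ : κ ∈ Ioo 0 c⁻¹) : ∃ a ∈ Ioc 0 c, ∀ n, Dig n c ρ (dualLine c κ a) := by
  have key : ∀ n, ∃ a ∈ Icc 0 c, Dig n c ρ (dualLine c κ a) := by
    intro n
    obtain ⟨t, ht, -, -, h⟩ := exists_dig (n := n) hρ hc0 hc1 (γ := dualLine c κ) hc0.le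
      (fun t ht => ((continuousAt_dualLine (c := c) hκ.1.le ht.1).comp
        (continuousAt_const.prodMk continuousAt_id)).continuousWithinAt)
      (fun t ht => ⟨ht.1, fun h => (dualLine_mem hc0 hc1 hκ ⟨h, ht.2⟩).1,
        (tau_dualLine_mem hc1 hκ.1.le ht.1).1.le, (tau_dualLine_mem hc1 hκ.1.le ht.1).2⟩) rfl rfl
    exact ⟨t, ht, h⟩
  choose A hA hdig using key
  obtain ⟨a, ha, φ, hφ, hlim⟩ := isCompact_Icc.tendsto_subseq hA
  refine ⟨a, dualLine_limit hc0 hc1 hκ ha tendsto_const_nhds hlim fun n => ?_⟩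
  filter_upwards [eventually_ge_atTop n] with i hi
  exact (hdig (φ i)).mono (hi.trans (hφ.le_apply))

end

/-! ### Comparison of two pairs under renormalization -/

section
variable {c : ℝ} {p p' : ℝ × ℝ}

/-- The pair `ζ_{p,c}` lies below the pair `ζ_{p',c}` in the coordinates `H` and `H'`. -/
structure Below (c : ℝ) (p p' : ℝ × ℝ) (H H' : ℝ → ℝ) (δ : ℝ) : Prop where
  zero : H 0 = H' 0
  mobF : ∀ y ∈ Icc (-1 : ℝ) 0, ∀ y' ∈ Icc (-1 : ℝ) 0, H y ≤ H' y' →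
    H (mobF c p y) + δ ≤ H' (mobF c p' y')
  mobG : ∀ y ∈ Icc 0 p.1, ∀ y' ∈ Icc 0 p'.1, H y ≤ H' y' → H (mobG c p y) ≤ H' (mobG c p' y')

lemma Ren.iterate_mem {r : ℕ} (h : Ren c r p) {u : ℝ} (hu : u ∈ Icc 0 p.1) {j : ℕ} (hj : j < r) :
    (BreakRenorm.mobF c p)^[j] (BreakRenorm.mobG c p u) ∈ Icc (-1 : ℝ) 0 := by
  have hp := h.1
  have hc := pos_of_mem hp
  have hx1 := orb_nonpos_of_le hp (Nat.succ_le_of_lt hj) h.2.1.le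
  have hx0 := (orb_neg_of_succ hp hx1).le
  have hge := orb_ge hp (j + 1)
  have hge0 := orb_ge hp j
  rw [iterate_mobG hp hu hx0]
  have hd := denom_pos hp ⟨hge0, hx0⟩ hu
  have hle := mt (orb_succ_pos_iff hp hx0).2 (not_lt.2 hx1)
  have d3 := one_sub_mul_pos (neg_one_lt_snd hp) ⟨hge0, hx0⟩
  rw [orb_succ_of_nonpos hp hx0, BreakRenorm.mobF, le_div_iff₀ d3] at hge
  generalize orb c p j = x at *
  have a0 := hp.1
  constructor
  · rw [le_div_iff₀ hd]
    have e : p.1 * (u / c + x) - -1 * (p.1 + ((1 - x * p.2) / c - 1) * u) =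
        (p.1 - u) * (1 + x) + u / c * (p.1 + c * x - -1 * (1 - p.2 * x)) := by
      field_simp; ring
    have h1 : 0 ≤ (p.1 - u) * (1 + x) := mul_nonneg (by linarith [hu.2]) (by linarith)
    have h2 : 0 ≤ u / c * (p.1 + c * x - -1 * (1 - p.2 * x)) :=
      mul_nonneg (div_nonneg hu.1 hc.le) (by linarith)
    linarith
  · refine div_nonpos_of_nonpos_of_nonneg (mul_nonpos_of_nonneg_of_nonpos a0.le ?_) hd.le
    have : u / c + x = (u + c * x) / c := by field_simp
    rw [this]
    exact div_nonpos_of_nonpos_of_nonneg (by linarith [hu.2]) hc.le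

/-- The coordinates are only transported by the rescaling. No monotonicity of H or H' is used, so
the orientation reversal of α does no harm. -/
lemma Below.renorm {H H' : ℝ → ℝ} {δ : ℝ} {r : ℕ} (h : Below c p p' H H' δ) (hδ : 0 ≤ δ)
    (hp : Ren c r p) (hp' : Ren c r p') :
    Below c⁻¹ (rmap c r p) (rmap c r p') (fun z => H (-(p.1 * z))) (fun z => H' (-(p'.1 * z))) δ := by
  have a0 := hp.1.1
  have a0' := hp'.1.1
  refine ⟨by simp [h.zero], fun y hy y' hy' hyy => ?_, fun y hy y' hy' hyy => ?_⟩
  · have hu : -(p.1 * y) ∈ Icc 0 p.1 := ⟨by nlinarith [hy.2], by nlinarith [hy.1]⟩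
    have hu' : -(p'.1 * y') ∈ Icc 0 p'.1 := ⟨by nlinarith [hy'.2], by nlinarith [hy'.1]⟩
    rw [← renormEta_eq hp hy, ← renormEta_eq hp' hy', renormEta, renormEta, mobF_zero, mobF_zero,
      mul_div_cancel₀ _ a0.ne', mul_div_cancel₀ _ a0'.ne', neg_neg, neg_neg]
    have key : ∀ j ≤ r, H ((BreakRenorm.mobF c p)^[j] (BreakRenorm.mobG c p (-(p.1 * y)))) ≤
        H' ((BreakRenorm.mobF c p')^[j] (BreakRenorm.mobG c p' (-(p'.1 * y')))) := by
      intro j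
      induction j with
      | zero => intro _; exact h.mobG _ hu _ hu' hyy
      | succ j ih =>
        intro hj
        rw [Function.iterate_succ_apply', Function.iterate_succ_apply']
        have := h.mobF _ (hp.iterate_mem hu hj) _ (hp'.iterate_mem hu' hj) (ih (by omega))
        linarith
    -- As r ≥ 1, the last map applied is F, which supplies the full gap δ again.
    obtain ⟨s, rfl⟩ : ∃ s, r = s + 1 := ⟨r - 1, by have := hp.one_le; omega⟩
    rw [Function.iterate_succ_apply', Function.iterate_succ_apply']
    exact h.mobF _ (hp.iterate_mem hu (by omega)) _ (hp'.iterate_mem hu' (by omega))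
      (key s (by omega))
  · have hsub : ∀ {q : ℝ × ℝ} {z : ℝ}, Ren c r q → z ∈ Icc 0 (rmap c r q).1 →
        -(q.1 * z) ∈ Icc (-1 : ℝ) 0 := by
      rintro q z hq ⟨h1, h2⟩
      have q0 := hq.1.1
      rw [rmap, le_div_iff₀ q0] at h2
      exact ⟨by nlinarith [orb_ge hq.1 r], by nlinarith⟩
    rw [← renormXi_eq hp hy, ← renormXi_eq hp' hy', renormXi, renormXi, mobF_zero, mobF_zero,
      mul_div_cancel₀ _ a0.ne', mul_div_cancel₀ _ a0'.ne', neg_neg, neg_neg]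
    have := h.mobF _ (hsub hp hy) _ (hsub hp' hy') hyy
    linarith

/-- A bound for the product of the scaling factors of two successive renormalizations. -/
def contr (c : ℝ) : ℝ := c / (min 1 c + c)

lemma contr_nonneg (hc0 : 0 < c) : 0 ≤ contr c :=
  div_nonneg hc0.le (add_nonneg (le_min zero_le_one hc0.le) hc0.le)

lemma contr_lt_one (hc0 : 0 < c) : contr c < 1 := by
  have : 0 < min 1 c := lt_min one_pos hc0
  rw [contr, div_lt_one (by positivity)]
  linarith

/-- The product of two successive scaling factors is a · a' = -x with x = F^r(-1). The bound adds
-cx < a, which says F(x) > 0, and -x(1 + v) ≤ c - a, which says x ≥ F(-1), using 1 + v ≥ min(1, c).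
-/
lemma Ren.neg_orb_le {r : ℕ} (h : Ren c r p) (hc1 : c ≠ 1) (hp : p ∈ invDomain c) :
    -orb c p r ≤ contr c := by
  have hc := pos_of_mem h.1
  have hm : 0 < min 1 c := lt_min one_pos hc
  obtain ⟨-, t0, t1⟩ := (mem_invDomain_iff hc1).1 hp
  have hv : min 1 c ≤ 1 + p.2 := by
    rw [← tau_mul hc1 (p := p)]
    have h1 := min_le_left 1 c
    have h2 := min_le_right 1 c
    nlinarith [mul_nonneg t0 (sub_nonneg.2 h2), mul_nonneg (sub_nonneg.2 t1) (sub_nonneg.2 h1)]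
  have h1 := (orb_succ_pos_iff h.1 h.2.1.le).1 h.2.2
  have h2 := orb_le h.1 h.one_le h.2.1.le
  rw [orb_one, div_le_iff₀ (by linarith [neg_one_lt_snd h.1])] at h2
  have h3 := mul_le_mul_of_nonneg_left hv (neg_nonneg.2 h.2.1.le)
  rw [contr, le_div_iff₀ (by positivity)]
  nlinarith

/-- After 2n renormalizations the gap is evaluated at F(0) = a for each pair; undoing the rescalings
multiplies these points by n factors of size at most `contr c`. -/
lemma Below.exists_small {H H' : ℝ → ℝ} {δ : ℝ} {n : ℕ} {ρ : ℕ → ℕ} (h : Below c p p' H H' δ)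
    (hδ : 0 ≤ δ) (hc1 : c ≠ 1) (hp : p ∈ invDomain c) (hp' : p' ∈ invDomain c)
    (hn : Dig (2 * n) c ρ p) (hn' : Dig (2 * n) c ρ p') :
    ∃ z z', |z| ≤ c * contr c ^ n ∧ |z'| ≤ c * contr c ^ n ∧ H z + δ ≤ H' z' := by
  have hc0 := pos_of_mem hp.1
  induction n generalizing p p' H H' ρ with
  | zero =>
    have hz : (0 : ℝ) ∈ Icc (-1 : ℝ) 0 := by norm_num
    have := h.mobF 0 hz 0 hz h.zero.le
    rw [mobF_zero, mobF_zero] at this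
    refine ⟨p.1, p'.1, ?_, ?_, this⟩
    · rw [abs_of_pos hp.1.1]; simpa using hp.1.2.1
    · rw [abs_of_pos hp'.1.1]; simpa using hp'.1.2.1
  | succ n ih =>
    obtain ⟨R1, R2, h3⟩ := hn
    obtain ⟨R1', R2', h3'⟩ := hn'
    have hc1' := inv_ne_one_of_ne hc1
    have b2 := (h.renorm hδ R1 R1').renorm hδ R2 R2'
    have m1 := (R1.rmap_mem_invDomain hc1 hp).1
    have m1' := (R1'.rmap_mem_invDomain hc1 hp').1
    have m2 := (R2.rmap_mem_invDomain hc1' m1).1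
    have m2' := (R2'.rmap_mem_invDomain hc1' m1').1
    rw [inv_inv] at b2 h3 h3' m2 m2'
    obtain ⟨z, z', hz, hz', hzz⟩ := ih b2 m2 m2' h3 h3'
    have bound : ∀ {q : ℝ × ℝ} {w : ℝ}, q ∈ invDomain c → Ren c (ρ 0) q →
        |w| ≤ c * contr c ^ n →
        |(-(q.1 * -((rmap c (ρ 0) q).1 * w)))| ≤ c * contr c ^ (n + 1) := by
      intro q w hq R hw
      have e : -(q.1 * -((rmap c (ρ 0) q).1 * w)) = -orb c q (ρ 0) * w := by
        have := hq.1.1.ne'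
        simp only [rmap]; field_simp
      rw [e, abs_mul, abs_of_pos (neg_pos.2 R.2.1), pow_succ]
      calc -orb c q (ρ 0) * |w| ≤ contr c * (c * contr c ^ n) :=
            mul_le_mul (R.neg_orb_le hc1 hq) hw (abs_nonneg _) (contr_nonneg hc0)
        _ = _ := by ring
    exact ⟨_, _, bound hp R1 hz, bound hp' R1' hz', hzz⟩

lemma mobG_denom_pos (hp : p ∈ paramDomain c) {z : ℝ} (hz : z ∈ Icc 0 p.1) :
    0 < p.1 * c + z * (1 + p.2 - c) := by
  have hc := pos_of_mem hp
  have hv := neg_one_lt_snd hp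
  have e : p.1 * c + z * (1 + p.2 - c) = c * (p.1 - z) + z * (1 + p.2) := by ring
  rw [e]
  rcases hz.2.eq_or_lt with h | h
  · rw [h]; nlinarith [mul_pos hp.1 (by linarith : 0 < 1 + p.2)]
  · have := mul_pos hc (sub_pos.2 h)
    have := mul_nonneg hz.1 (by linarith : 0 ≤ 1 + p.2)
    linarith

lemma mobG_strictMonoOn (hp : p ∈ paramDomain c) : StrictMonoOn (mobG c p) (Icc 0 p.1) := by
  intro x hx y hy hxy
  have hc := pos_of_mem hp
  obtain ⟨h1, h2, h3⟩ := id hp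
  rw [mobG, mobG, div_lt_div_iff₀ (mobG_denom_pos hp hx) (mobG_denom_pos hp hy)]
  nlinarith [mul_pos (mul_pos (mul_pos h1 hc) (by linarith : 0 < p.1 + p.2 + 1 - c))
    (sub_pos.2 hxy)]

lemma mobG_nonpos (hp : p ∈ paramDomain c) {z : ℝ} (hz : z ∈ Icc 0 p.1) : mobG c p z ≤ 0 := by
  refine div_nonpos_of_nonpos_of_nonneg ?_ (mobG_denom_pos hp hz).le
  exact mul_nonpos_of_nonneg_of_nonpos hp.1.le (by linarith [hz.2, hp.2.1])

lemma mobF_mem (hp : p ∈ paramDomain c) {y : ℝ} (hy : y ∈ Icc (-1 : ℝ) 0) :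
    mobF c p y ≤ p.1 := by
  rw [← mobF_zero c p]
  exact (mobF_strictMonoOn hp).monotoneOn hy (right_mem_Icc.2 (by norm_num)) hy.2

lemma continuousOn_mobF (hp : p ∈ paramDomain c) : ContinuousOn (mobF c p) (Icc (-1) 0) := by
  refine ContinuousOn.div (by fun_prop) (by fun_prop) fun z hz => ?_
  exact (one_sub_mul_pos (neg_one_lt_snd hp) hz).ne'

lemma continuousOn_mobG (hp : p ∈ paramDomain c) : ContinuousOn (mobG c p) (Icc 0 p.1) := by
  refine ContinuousOn.div (by fun_prop) (by fun_prop) fun z hz => ?_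
  exact (mobG_denom_pos hp hz).ne'

/-- The coordinate that is the identity on `[-1, 0]` and equals `G + 1` on `[0, a]`. -/
def coord (c : ℝ) (p : ℝ × ℝ) (z : ℝ) : ℝ := min z 0 + (mobG c p (max z 0) + 1)

lemma coord_of_nonpos (hp : p ∈ paramDomain c) {z : ℝ} (hz : z ≤ 0) : coord c p z = z := by
  rw [coord, min_eq_left hz, max_eq_right hz, mobG_zero (pos_of_mem hp).ne' hp.1.ne']
  ring

lemma coord_of_nonneg {z : ℝ} (hz : 0 ≤ z) : coord c p z = mobG c p z + 1 := by
  rw [coord, min_eq_right hz, max_eq_left hz, zero_add]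

lemma max_zero_mem (hp : p ∈ paramDomain c) {z : ℝ} (hz : z ≤ p.1) : max z 0 ∈ Icc 0 p.1 :=
  ⟨le_max_right _ _, max_le hz hp.1.le⟩

lemma coord_monotoneOn (hp : p ∈ paramDomain c) : MonotoneOn (coord c p) (Iic p.1) := by
  intro x hx y hy hxy
  have h1 := (mobG_strictMonoOn hp).monotoneOn (max_zero_mem hp hx) (max_zero_mem hp hy)
    (max_le_max_right 0 hxy)
  have h2 := min_le_min_right 0 hxy
  simp only [coord]
  linarith

lemma continuousOn_coord (hp : p ∈ paramDomain c) : ContinuousOn (coord c p) (Iic p.1) := by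
  refine (continuous_id.min continuous_const).continuousOn.add
    (ContinuousOn.add ?_ continuousOn_const)
  exact (continuousOn_mobG hp).comp (continuous_id.max continuous_const).continuousOn
    fun z hz => max_zero_mem hp hz

lemma coord_pos (hp : p ∈ paramDomain c) {z : ℝ} (hz : z ∈ Ioc 0 p.1) : 0 < coord c p z := by
  rw [coord_of_nonneg hz.1.le]
  have := mobG_strictMonoOn hp (left_mem_Icc.2 hp.1.le) ⟨hz.1.le, hz.2⟩ hz.1
  rw [mobG_zero (pos_of_mem hp).ne' hp.1.ne'] at this
  linarith

/-- On [0, a] the coordinate is G + 1, so the comparison of the maps G is automatic and only F must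
be compared. Compactness of [-1, 0] makes the gap uniform. -/
lemma exists_below (hp : p ∈ paramDomain c) (hp' : p' ∈ paramDomain c)
    (h : ∀ y ∈ Icc (-1 : ℝ) 0, coord c p (mobF c p y) < coord c p' (mobF c p' y)) :
    ∃ δ > 0, Below c p p' (coord c p) (coord c p') δ := by
  have hcont : ∀ {q : ℝ × ℝ}, q ∈ paramDomain c →
      ContinuousOn (fun y => coord c q (mobF c q y)) (Icc (-1) 0) := fun hq =>
    (continuousOn_coord hq).comp (continuousOn_mobF hq) fun y hy => mobF_mem hq hy
  obtain ⟨y₀, hy₀, hmin⟩ := isCompact_Icc.exists_isMinOn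
    (nonempty_Icc.2 (by norm_num : (-1 : ℝ) ≤ 0)) ((hcont hp').sub (hcont hp))
  refine ⟨_, sub_pos.2 (h y₀ hy₀), ?_, fun y hy y' hy' hyy => ?_, fun y hy y' hy' hyy => ?_⟩
  · rw [coord_of_nonpos hp le_rfl, coord_of_nonpos hp' le_rfl]
  · rw [coord_of_nonpos hp hy.2, coord_of_nonpos hp' hy'.2] at hyy
    have h1 := hmin hy
    simp only [mem_ofPred_eq, Pi.sub_apply] at h1
    have h2 := coord_monotoneOn hp' (mobF_mem hp' hy) (mobF_mem hp' hy')
      ((mobF_strictMonoOn hp').monotoneOn hy hy' hyy)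
    linarith
  · rw [coord_of_nonneg hy.1, coord_of_nonneg hy'.1] at hyy
    rw [coord_of_nonpos hp (mobG_nonpos hp hy), coord_of_nonpos hp' (mobG_nonpos hp' hy')]
    linarith

lemma not_dig_of_coord_lt {ρ : ℕ → ℕ} (hc1 : c ≠ 1) (hp : p ∈ invDomain c) (hp' : p' ∈ invDomain c)
    (h : ∀ y ∈ Icc (-1 : ℝ) 0, coord c p (mobF c p y) < coord c p' (mobF c p' y))
    (hd : ∀ n, Dig n c ρ p) (hd' : ∀ n, Dig n c ρ p') : False := by
  have hc0 := pos_of_mem hp.1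
  obtain ⟨δ, hδ, hB⟩ := exists_below hp.1 hp'.1 h
  choose z z' hz hz' hzz using fun n => hB.exists_small hδ.le hc1 hp hp' (hd (2 * n)) (hd' (2 * n))
  have hlim : Tendsto (fun n => c * contr c ^ n) atTop (𝓝 0) := by
    simpa using (tendsto_pow_atTop_nhds_zero_of_lt_one (contr_nonneg hc0)
      (contr_lt_one hc0)).const_mul c
  have key : ∀ {q : ℝ × ℝ} {w : ℕ → ℝ}, q ∈ paramDomain c → (∀ n, |w n| ≤ c * contr c ^ n) →
      Tendsto (fun n => coord c q (w n)) atTop (𝓝 0) := by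
    intro q w hq hw
    have h1 : Tendsto w atTop (𝓝 0) := squeeze_zero_norm hw hlim
    have h2 : ContinuousAt (coord c q) 0 :=
      (continuousOn_coord hq).continuousAt (Iic_mem_nhds hq.1)
    have := h2.tendsto.comp h1
    rwa [coord_of_nonpos hq le_rfl] at this
  have := le_of_tendsto_of_tendsto' ((key hp.1 hz).add_const δ) (key hp'.1 hz') hzz
  linarith

end

/-! ### Monotonicity along the dual lines -/

section
variable {c κ a b : ℝ}

lemma mobF_dualLine_lt (hc0 : 0 < c) (hc1 : c ≠ 1) (hκ : κ ∈ Ioo 0 c⁻¹) (ha : a ∈ Ioc 0 c)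
    (hb : b ∈ Ioc 0 c) (hab : a < b) {y : ℝ} (hy : y ∈ Icc (-1 : ℝ) 0) (h : 1 < c ∨ a + c * y ≤ 0) :
    mobF c (dualLine c κ a) y < mobF c (dualLine c κ b) y := by
  have hva := neg_one_lt_snd (dualLine_mem hc0 hc1 hκ ha).1
  have hvb := neg_one_lt_snd (dualLine_mem hc0 hc1 hκ hb).1
  rw [mobF, mobF, div_lt_div_iff₀ (one_sub_mul_pos hva hy) (one_sub_mul_pos hvb hy)]
  have hk : κ * c < 1 := by
    have := hκ.2
    rwa [inv_eq_one_div, lt_div_iff₀ hc0] at this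
  have k0 := hκ.1
  obtain ⟨a0, a1⟩ := ha
  obtain ⟨b0, b1⟩ := hb
  obtain ⟨y0, y1⟩ := hy
  simp only [dualLine]
  have sa0 : 0 < 1 / (1 + a * κ) := by positivity
  have sb0 : 0 < 1 / (1 + b * κ) := by positivity
  have sa1 : 1 / (1 + a * κ) ≤ 1 := by
    rw [div_le_one (by positivity)]; linarith [mul_pos a0 k0]
  have sb1 : 1 / (1 + b * κ) ≤ 1 := by
    rw [div_le_one (by positivity)]; linarith [mul_pos b0 k0]
  have e : 1 / (1 + a * κ) - 1 / (1 + b * κ) =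
      κ * (b - a) * (1 / (1 + a * κ)) * (1 / (1 + b * κ)) := by
    field_simp; ring
  generalize 1 / (1 + a * κ) = s at *
  generalize 1 / (1 + b * κ) = t at *
  -- After cross-multiplication the difference is b - a times this factor. For c ≤ 1 it needs a + cy
  -- ≤ 0; for c > 1 it follows from κtc < 1.
  have key : 0 < 1 + s * (c - 1) * (-y) * (1 + (a + c * y) * (κ * t)) := by
    have hkt0 : 0 < κ * t := mul_pos k0 sb0
    have hkt1 : κ * t * c < 1 := by nlinarith
    rcases le_or_gt c 1 with hc | hc
    · have hs : a + c * y ≤ 0 := h.resolve_left (not_lt.2 hc)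
      have hw0 : 0 ≤ s * (1 - c) * (-y) :=
        mul_nonneg (mul_nonneg sa0.le (sub_nonneg.2 hc)) (by linarith)
      have hw1 : s * (1 - c) * (-y) < 1 := by
        calc s * (1 - c) * (-y) ≤ 1 * (1 - c) * 1 := by
              gcongr
              · linarith
              · linarith
          _ < 1 := by linarith
      have hf : 1 + (a + c * y) * (κ * t) ≤ 1 := by nlinarith
      nlinarith [mul_le_mul_of_nonneg_left hf hw0]
    · have hw0 : 0 ≤ s * (c - 1) * (-y) :=
        mul_nonneg (mul_nonneg sa0.le (sub_nonneg.2 hc.le)) (by linarith)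
      have hf : 0 ≤ 1 + (a + c * y) * (κ * t) := by nlinarith
      nlinarith [mul_nonneg hw0 hf]
  have := mul_pos (sub_pos.2 hab) key
  have e2 : (b + c * y) * (1 - s * (c - 1) * y) - (a + c * y) * (1 - t * (c - 1) * y) =
      (b - a) * (1 + s * (c - 1) * (-y) * (1 + (a + c * y) * (κ * t))) := by
    linear_combination (-(a + c * y) * (c - 1) * y) * e
  linarith

lemma mobG_dualLine (hκ : 0 < κ) (ha : 0 < a) (z : ℝ) :
    mobG c (dualLine c κ a) z = (z - c) / (c - z * κ * (1 / (1 + a * κ)) * (c - 1)) := by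
  simp only [mobG, dualLine]
  have h1 : 0 < 1 + a * κ := by positivity
  have : a * c + z * (1 + 1 / (1 + a * κ) * (c - 1) - c) =
      a * (c - z * κ * (1 / (1 + a * κ)) * (c - 1)) := by
    field_simp; ring
  rw [this, mul_div_mul_left _ _ ha.ne']

lemma dualLine_snd_eq (hκ : 0 < κ) (ha : 0 < a) :
    a * κ * (dualLine c κ a).2 = c - 1 - (dualLine c κ a).2 := by
  have h1 : 0 < 1 + a * κ := by positivity
  simp only [dualLine]; field_simp; ring

lemma mobG_mobF_dualLine (hc0 : 0 < c) (hc1 : c ≠ 1) (hκ : κ ∈ Ioo 0 c⁻¹) (ha : a ∈ Ioc 0 c) {y : ℝ}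
    (hy : y ∈ Icc (-1 : ℝ) 0) :
    mobG c (dualLine c κ a) (mobF c (dualLine c κ a) y) =
      ((a - c) * (1 + (dualLine c κ a).2)⁻¹ + c * y) /
        (1 - c * (1 - (1 + (dualLine c κ a).2)⁻¹) * (1 + κ) * y) := by
  have hv := neg_one_lt_snd (dualLine_mem hc0 hc1 hκ ha).1
  have hd := one_sub_mul_pos hv hy
  have hk := dualLine_snd_eq (c := c) hκ.1 ha.1
  rw [mobG_dualLine hκ.1 ha.1, mul_assoc _ (1 / (1 + a * κ))]
  change (mobF c (dualLine c κ a) y - c) / (c - mobF c (dualLine c κ a) y * κ *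
    (dualLine c κ a).2) = _
  rw [mobF]
  change ((a + c * y) / _ - c) / (c - (a + c * y) / _ * κ * _) = _
  generalize (dualLine c κ a).2 = v at *
  have hv' : 0 < 1 + v := by linarith
  have hd' : 1 - y * v ≠ 0 := by rw [mul_comm]; exact hd.ne'
  have e1 : (a + c * y) / (1 - v * y) - c =
      (1 + v) / (1 - v * y) * ((a - c) * (1 + v)⁻¹ + c * y) := by
    field_simp; ring
  have e2 : c - (a + c * y) / (1 - v * y) * κ * v =
      (1 + v) / (1 - v * y) * (1 - c * (1 - (1 + v)⁻¹) * (1 + κ) * y) := by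
    field_simp
    linear_combination -hk
  rw [e1, e2, mul_div_mul_left _ _ (div_pos hv' hd).ne']

lemma coord_dualLine_lt (hc0 : 0 < c) (hc1 : c ≠ 1) (hκ : κ ∈ Ioo 0 c⁻¹) (ha : a ∈ Ioc 0 c)
    (hb : b ∈ Ioc 0 c) (hab : a < b) {y : ℝ} (hy : y ∈ Icc (-1 : ℝ) 0) :
    coord c (dualLine c κ a) (mobF c (dualLine c κ a) y) <
      coord c (dualLine c κ b) (mobF c (dualLine c κ b) y) := by
  have hp := (dualLine_mem hc0 hc1 hκ ha).1
  have hp' := (dualLine_mem hc0 hc1 hκ hb).1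
  have hva := neg_one_lt_snd hp
  have hvb := neg_one_lt_snd hp'
  have hda := one_sub_mul_pos hva hy
  have hdb := one_sub_mul_pos hvb hy
  have hFa := mobF_mem hp hy
  have hFb := mobF_mem hp' hy
  rcases le_or_gt (a + c * y) 0 with h | h
  · have hx : mobF c (dualLine c κ a) y ≤ 0 := div_nonpos_of_nonpos_of_nonneg h hda.le
    have hlt := mobF_dualLine_lt hc0 hc1 hκ ha hb hab hy (Or.inr h)
    rw [coord_of_nonpos hp hx]
    rcases le_or_gt (mobF c (dualLine c κ b) y) 0 with h' | h'
    · rwa [coord_of_nonpos hp' h']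
    · exact hx.trans_lt (coord_pos hp' ⟨h', hFb⟩)
  · have hx : 0 < mobF c (dualLine c κ a) y := div_pos h hda
    have hx' : 0 < mobF c (dualLine c κ b) y :=
      div_pos (by simp only [dualLine]; linarith) hdb
    rw [coord_of_nonneg hx.le, coord_of_nonneg hx'.le, add_lt_add_iff_right]
    have hss : 1 / (1 + b * κ) < 1 / (1 + a * κ) := by
      have := mul_pos ha.1 hκ.1
      exact one_div_lt_one_div_of_lt (by linarith) (by nlinarith [hκ.1])
    rcases le_or_gt c 1 with hc | hc
    -- When c < 1 and F is positive, `mobF_dualLine_lt` is not available, so G ∘ F is compared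
    -- directly: its numerator is nonpositive and increases with a, while its positive denominator
    -- does not decrease.
    · have hc := lt_of_le_of_ne hc hc1
      rw [mobG_mobF_dualLine hc0 hc1 hκ ha hy, mobG_mobF_dualLine hc0 hc1 hκ hb hy]
      have hvv : (dualLine c κ a).2 < (dualLine c κ b).2 := by
        simp only [dualLine]; nlinarith
      have hv0 : (dualLine c κ b).2 < 0 := by
        simp only [dualLine]
        have := mul_pos hb.1 hκ.1
        exact mul_neg_of_pos_of_neg (by positivity) (by linarith)
      have hD : 0 < 1 - c * (1 - (1 + (dualLine c κ a).2)⁻¹) * (1 + κ) * y := by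
        have hk := dualLine_snd_eq (c := c) hκ.1 ha.1
        generalize (dualLine c κ a).2 = v at *
        have h1 : 0 < 1 + v := by linarith
        have e : 1 - c * (1 - (1 + v)⁻¹) * (1 + κ) * y =
            (c * (1 - v * y) + (a + c * y) * κ * -v) * (1 + v)⁻¹ := by
          field_simp
          linear_combination hk
        have h2 := mul_pos (mul_pos h hκ.1) (by linarith : 0 < -v)
        rw [e]
        positivity
      generalize (dualLine c κ a).2 = v at *
      generalize (dualLine c κ b).2 = w at *
      have hs0 : 0 < (1 + w)⁻¹ := inv_pos.2 (by linarith)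
      have hs : (1 + w)⁻¹ < (1 + v)⁻¹ := inv_strictAnti₀ (by linarith) (by linarith)
      generalize (1 + v)⁻¹ = s at *
      generalize (1 + w)⁻¹ = t at *
      have hDD : 1 - c * (1 - s) * (1 + κ) * y ≤ 1 - c * (1 - t) * (1 + κ) * y := by
        have := mul_nonneg (mul_nonneg (mul_pos hc0 (sub_pos.2 hs)).le (by linarith [hκ.1] : 0 ≤ 1 + κ))
          (neg_nonneg.2 hy.2)
        linarith
      have hN : (a - c) * s + c * y ≤ 0 := by
        nlinarith [hy.2, mul_nonneg (sub_nonneg.2 ha.2) (hs0.trans hs).le]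
      have hNN : (a - c) * s + c * y < (b - c) * t + c * y := by
        have h1 := mul_pos (by linarith [hb.2] : 0 < c - a) (sub_pos.2 hs)
        have h2 := mul_pos (sub_pos.2 hab) hs0
        linarith
      calc _ ≤ ((a - c) * s + c * y) / (1 - c * (1 - t) * (1 + κ) * y) := by
            rw [div_le_div_iff₀ hD (hD.trans_le hDD)]
            exact mul_le_mul_of_nonpos_left hDD hN
        _ < _ := div_lt_div_of_pos_right hNN (hD.trans_le hDD)
    · have hlt := mobF_dualLine_lt hc0 hc1 hκ ha hb hab hy (Or.inl hc)
      refine lt_of_le_of_lt ?_ (mobG_strictMonoOn hp' ⟨hx.le, hFa.trans hab.le⟩ ⟨hx'.le, hFb⟩ hlt)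
      have d1 := mobG_denom_pos hp ⟨hx.le, hFa⟩
      have hFa' : mobF c (dualLine c κ a) y ≤ a := hFa
      generalize mobF c (dualLine c κ a) y = x at *
      rw [mobG_dualLine hκ.1 ha.1, mobG_dualLine hκ.1 hb.1]
      have d1 : 0 < c - x * κ * (1 / (1 + a * κ)) * (c - 1) := by
        have e : a * c + x * (1 + 1 / (1 + a * κ) * (c - 1) - c) =
            a * (c - x * κ * (1 / (1 + a * κ)) * (c - 1)) := by
          have := mul_pos ha.1 hκ.1
          have : 0 < 1 + a * κ := by linarith
          field_simp; ring
        simp only [dualLine] at d1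
        rw [e] at d1
        exact pos_of_mul_pos_right d1 ha.1.le
      have hDD : c - x * κ * (1 / (1 + a * κ)) * (c - 1) ≤
          c - x * κ * (1 / (1 + b * κ)) * (c - 1) := by
        have := mul_nonneg (mul_nonneg (mul_nonneg hx.le hκ.1.le) (sub_pos.2 hss).le)
          (by linarith : 0 ≤ c - 1)
        linarith
      rw [div_le_div_iff₀ d1 (d1.trans_le hDD)]
      exact mul_le_mul_of_nonpos_left hDD (by linarith [ha.2])

end

/-! ### The backward curve as a graph -/

section
variable {c κ : ℝ} {ρ : ℕ → ℕ}

lemma dualLine_unique {a b : ℝ} (hc0 : 0 < c) (hc1 : c ≠ 1) (hκ : κ ∈ Ioo 0 c⁻¹)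
    (ha : a ∈ Ioc 0 c) (hb : b ∈ Ioc 0 c) (hda : ∀ n, Dig n c ρ (dualLine c κ a))
    (hdb : ∀ n, Dig n c ρ (dualLine c κ b)) : a = b := by
  rcases lt_trichotomy a b with h | h | h
  · exact (not_dig_of_coord_lt hc1 (dualLine_mem hc0 hc1 hκ ha) (dualLine_mem hc0 hc1 hκ hb)
      (fun y hy => coord_dualLine_lt hc0 hc1 hκ ha hb h hy) hda hdb).elim
  · exact h
  · exact (not_dig_of_coord_lt hc1 (dualLine_mem hc0 hc1 hκ hb) (dualLine_mem hc0 hc1 hκ ha)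
      (fun y hy => coord_dualLine_lt hc0 hc1 hκ hb ha h hy) hdb hda).elim

/-- Any cluster value of A at κ again realizes all the heights on the line of κ, so uniqueness
identifies it with A κ; values lie in a compact interval. -/
lemma continuousOn_of_dig {A : ℝ → ℝ} (hc0 : 0 < c) (hc1 : c ≠ 1)
    (hA : ∀ κ ∈ Ioo 0 c⁻¹, A κ ∈ Ioc 0 c ∧ ∀ n, Dig n c ρ (dualLine c κ (A κ))) :
    ContinuousOn A (Ioo 0 c⁻¹) := by
  intro κ hκ
  refine isCompact_Icc.tendsto_nhds_of_unique_mapClusterPt (s := Icc 0 c)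
    (eventually_mem_nhdsWithin.mono fun x hx => Ioc_subset_Icc_self (hA x hx).1) fun a ha hcl => ?_
  obtain ⟨U, hU, hlim⟩ := mapClusterPt_iff_ultrafilter.1 hcl
  obtain ⟨h1, h2⟩ := dualLine_limit (ρ := ρ) (K := id) hc0 hc1 hκ ha
    (tendsto_id'.2 (hU.trans nhdsWithin_le_nhds)) hlim
    fun n => hU (eventually_mem_nhdsWithin.mono fun x hx => (hA x hx).2 n)
  exact dualLine_unique hc0 hc1 hκ h1 (hA κ hκ).1 h2 (hA κ hκ).2

lemma isContinuousCurve_graph {g : ℝ → ℝ} {J : Set ℝ} (hJ : J.OrdConnected) (hJ' : J.Nontrivial)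
    (hg : ContinuousOn g J) : IsContinuousCurve ((fun x => (x, g x)) '' J) := by
  refine ⟨J, hJ, hJ', ⟨⟨⟨fun x => ⟨(x, g x), mem_image_of_mem _ x.2⟩,
    fun q => ⟨q.1.1, ?_⟩, fun x => rfl, ?_⟩, ?_, ?_⟩⟩⟩
  · obtain ⟨_, x, hx, rfl⟩ := q
    exact hx
  · rintro ⟨_, x, hx, rfl⟩
    rfl
  · exact (continuous_subtype_val.prodMk hg.domRestrict).subtype_mk _
  · exact (continuous_fst.comp continuous_subtype_val).subtype_mk _

lemma dualityMap_image_eq {A : ℝ → ℝ} {r : ℤ → ℕ} (hc0 : 0 < c) (hc1 : c ≠ 1)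
    (hA : ∀ κ ∈ Ioo 0 c⁻¹,
      A κ ∈ Ioc 0 c ∧ ∀ n, Dig n c (fun i => r i) (dualLine c κ (A κ))) :
    dualityMap c '' (forwardCurve c r ∩ dualityDomain c) =
      (fun κ => (κ, 1 / (1 + A κ * κ) * (c⁻¹ - 1))) '' Ioo 0 c⁻¹ := by
  ext q
  constructor
  · rintro ⟨p, ⟨hp, hpE⟩, rfl⟩
    obtain ⟨h1, h2⟩ := mem_forwardCurve_iff.1 hp
    have hD := (mem_dualityDomain_iff hc0 hc1 h1).1 hpE
    have hκ : (dualityMap c p).1 ∈ Ioo 0 c⁻¹ := ⟨(hD.dual_mem hc1).1.1, hD.2.2.2⟩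
    have e := eq_dualLine hc0 hc1 hD.2.1 h1.1.1
    obtain ⟨h3, h4⟩ := hA _ hκ
    have hp1 : p.1 ∈ Ioc 0 c := ⟨h1.1.1, h1.1.2.1⟩
    have e2 : p.1 = A (dualityMap c p).1 :=
      dualLine_unique hc0 hc1 hκ hp1 h3 (fun n => e ▸ h2 n) h4
    refine ⟨(dualityMap c p).1, hκ, ?_⟩
    have e3 := dualityMap_dualLine hc0 hc1 hκ.1 hp1.1
    rw [← e] at e3
    simp only
    rw [← e2]
    exact e3.symm
  · rintro ⟨κ, hκ, rfl⟩
    obtain ⟨h1, h2⟩ := hA κ hκ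
    have hm := dualLine_mem hc0 hc1 hκ h1
    have e := dualityMap_dualLine hc0 hc1 hκ.1 h1.1
    refine ⟨dualLine c κ (A κ), ⟨mem_forwardCurve_iff.2 ⟨hm, h2⟩, ?_⟩, e⟩
    have hpos := mul_pos h1.1 hκ.1
    rw [mem_dualityDomain_iff hc0 hc1 hm, Dualizable, e, tau_dualLine hc1]
    refine ⟨hm, by positivity, ?_, hκ.2⟩
    rw [div_lt_one (by positivity)]
    linarith

end

end BreakRenorm

end

theorem mainTheorem9 (c : ℝ) (hc0 : 0 < c) (hc1 : c ≠ 1) (r : ℤ → ℕ) (hr : ∀ i, 1 ≤ r i) :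
    BreakRenorm.backwardCurve c⁻¹ r =
        BreakRenorm.dualityMap c ''
          (BreakRenorm.forwardCurve c (fun i => r (-1 - i)) ∩ BreakRenorm.dualityDomain c) ∧
      BreakRenorm.IsContinuousCurve (BreakRenorm.backwardCurve c⁻¹ r) := by
  have heq := BreakRenorm.backwardCurve_eq hc0 hc1 r
  refine ⟨heq, ?_⟩
  choose! A hA using fun (κ : ℝ) (hκ : κ ∈ Ioo 0 c⁻¹) => BreakRenorm.exists_dualLine
    (ρ := fun i : ℕ => r (-1 - i)) (fun i => hr _) hc0 hc1 hκ
  rw [heq, BreakRenorm.dualityMap_image_eq (r := fun i => r (-1 - i)) hc0 hc1 hA]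
  refine BreakRenorm.isContinuousCurve_graph ordConnected_Ioo
    (Ioo_infinite (inv_pos.2 hc0)).nontrivial ?_
  have hcont := BreakRenorm.continuousOn_of_dig hc0 hc1 hA
  refine (ContinuousOn.div continuousOn_const
    (continuousOn_const.add (hcont.mul continuousOn_id)) fun κ hκ => ?_).mul continuousOn_const
  exact (add_pos one_pos (mul_pos (hA κ hκ).1.1 hκ.1)).ne'
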